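/- A \emph{potential} is a piecewise continuous function $u:\mathbb R\to\mathbb R$ that attains its maximum at exactly one point $S(u)$; write $\mathcal M(u)=u(S(u))$. It is \emph{centered} if $S(u)=0$ and $\mathcal M(u)=0$, and \emph{unimodal} if it is nondecreasing on $(-\infty,S(u))$ and nonincreasing on $(S(u),\infty)$. For a unimodal potential $u$ and $w=(E,U)$ with $E>0$, $0<U<1$, put $x_*=S(u)$ and $\mathcal M=\mathcal M(u)$, let $z>0$ be the unique number with $\int_{x_*-z}^{x_*+z}(\mathcal M-u)\,dx=E$, let $a=\mathcal M-u(x_*-z)$ and $b=\mathcal M-u(x_*+z)$, and let $x^*=x_*-z$ if $U\le \frac{a}{a+b}$ and $x^*=x_*+z$ otherwise. Define $\mathcal H_w(u)$ to be the function equal to $\mathcal M+1$ at $x^*$, to $\mathcal M$ at the other points of $[x_*-z,x_*+z]$, and to $u$ elsewhere. Let $E_1,E_2,\dots$ be standard exponential and $U_1,U_2,\dots$ uniform on $(0,1)$, all independent, and let $w_n=(E_n,U_n)$. The \emph{greedy walk} generated by a centered unimodal potential $u$ is $S_n=S(u_n)$, where $u_0=u$ and $u_n=\mathcal H_{w_n}(u_{n-1})$.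 Let $\ell_j=\lceil 12j^{1/4}+1\rceil$ for $j\ge 1$. \textbf{Proposition 1.} For every $\varepsilon>0$ there is a $\delta>0$, depending on $\varepsilon$ but not on $u$, such that for every centered unimodal potential $u$ there are finite stopping times $L_0,L_1,L_2,\dots$ with respect to the filtration $\sigma(S_0,\dots,S_n)$, $n\ge 0$, with the following property. Let $\sigma=\operatorname{sgn}S_1$, $Z_j=\sigma S_{L_j}$, $N_j=L_j-u(S_{L_j})$, $Q_j=L_{j+1}-L_j$ and $X_j=Z_{j+1}-Z_j$. Then, with probability at least $\delta$, for all $j=1,2,3,\dots$: $$Q_j\in\{\ell_j,\ \ell_j+1\},\qquad (1-\varepsilon)\frac{\ell_j-1}{N_{j+1}}\le X_j\le(1+\varepsilon)\frac{\ell_j}{N_j},$$ and $$Z_{j-1}<\sigma S_n<Z_{j+1}\qquad\text{for all } n \text{ with } L_j\le n<L_{j+1}.$$ -/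

import Mathlib

open MeasureTheory ProbabilityTheory Filter Topology

namespace GreedyWalk

noncomputable section

/-- Piecewise continuity on the line: every bounded interval contains only finitely many
discontinuities, and one-sided (finite) limits exist everywhere. -/
def PiecewiseContinuous (u : ℝ → ℝ) : Prop :=
  (∀ a b : ℝ, {x ∈ Set.Icc a b | ¬ ContinuousAt u x}.Finite) ∧
    ∀ x : ℝ, (∃ l : ℝ, Tendsto u (𝓝[<] x) (𝓝 l)) ∧ ∃ r : ℝ, Tendsto u (𝓝[>] x) (𝓝 r)

/-- A potential is a piecewise continuous function attaining its maximum at exactly one point. -/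
def IsPotential (u : ℝ → ℝ) : Prop :=
  PiecewiseContinuous u ∧ ∃! x : ℝ, ∀ y : ℝ, u y ≤ u x

/-- `S(u)`: the point where the potential `u` attains its maximum. -/
def peak (u : ℝ → ℝ) : ℝ :=
  Classical.epsilon fun x : ℝ => ∀ y : ℝ, u y ≤ u x

/-- `M(u)`: the maximum of the potential `u`. -/
def height (u : ℝ → ℝ) : ℝ := u (peak u)

/-- The potential is centered: `S(u) = 0` and `M(u) = 0`. -/
def IsCentered (u : ℝ → ℝ) : Prop := peak u = 0 ∧ height u = 0

/-- The potential is nondecreasing to the left of its peak and nonincreasing to the right. -/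
def IsUnimodal (u : ℝ → ℝ) : Prop :=
  MonotoneOn u (Set.Iio (peak u)) ∧ AntitoneOn u (Set.Ioi (peak u))

/-- The number `z > 0` for which the area between the level `M(u)` and the graph of `u`, over
`[S(u) - z, S(u) + z]`, equals `e`. For a unimodal potential and `e > 0` there is exactly one such
`z`, so that the infimum is over a one-point set. -/
def radius (e : ℝ) (u : ℝ → ℝ) : ℝ :=
  sInf {z : ℝ | 0 < z ∧ ∫ x in (peak u - z)..(peak u + z), (height u - u x) = e}

/-- The new position `x^*`, given `w = (E, U)`. -/
def nextPoint (w : ℝ × ℝ) (u : ℝ → ℝ) : ℝ :=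
  let z := radius w.1 u
  let a := height u - u (peak u - z)
  let b := height u - u (peak u + z)
  if w.2 ≤ a / (a + b) then peak u - z else peak u + z

open Classical in
/-- The operator `H_w` on potentials, `w = (E, U)`. -/
def stepOp (w : ℝ × ℝ) (u : ℝ → ℝ) : ℝ → ℝ := fun x =>
  if x = nextPoint w u then height u + 1
  else if x ∈ Set.Icc (peak u - radius w.1 u) (peak u + radius w.1 u) then height u
  else u x

/-- The sequence of potentials `u_0 = u`, `u_{n+1} = H_w (u_n)` with `w` the `n`-th entry of the
driving sequence (which is indexed from `0` here: entry `n` drives the `(n+1)`-st step). -/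
def potentialSeq (u : ℝ → ℝ) (w : ℕ → ℝ × ℝ) : ℕ → ℝ → ℝ
  | 0 => u
  | n + 1 => stepOp (w n) (potentialSeq u w n)

/-- The greedy walk `S_n = S(u_n)` driven by random variables `E` and `U`. -/
def walk {Ω : Type*} (u : ℝ → ℝ) (E U : ℕ → Ω → ℝ) (n : ℕ) (ω : Ω) : ℝ :=
  peak (potentialSeq u (fun k => (E k ω, U k ω)) n)

/-- The natural filtration `n ↦ σ(S_0, …, S_n)` of a real process. (It is formed inside the power
set of `Ω`, so that no measurability proof is part of the definition; the generated
σ-algebras themselves do not depend on this.) -/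
def history {Ω : Type*} (S : ℕ → Ω → ℝ) : Filtration ℕ (⊤ : MeasurableSpace Ω) :=
  Filtration.natural (m := ⊤) S (fun _ => measurable_from_top.stronglyMeasurable)

/-- `E_0, E_1, …` are standard exponential, `U_0, U_1, …` are uniform on `(0, 1)`, and all these
random variables are jointly independent. -/
structure IsDriving {Ω : Type*} [MeasurableSpace Ω] (P : Measure Ω) (E U : ℕ → Ω → ℝ) :
    Prop where
  measurable_E : ∀ n, Measurable (E n)
  measurable_U : ∀ n, Measurable (U n)
  law_E : ∀ n, P.map (E n) = expMeasure 1
  law_U : ∀ n, P.map (U n) = volume.restrict (Set.Ioo (0 : ℝ) 1)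
  indep : iIndepFun (Sum.elim E U : ℕ ⊕ ℕ → Ω → ℝ) P

/-- `ℓ_j = ⌈12 j^{1/4} + 1⌉`. -/
def blockLen (j : ℕ) : ℕ := ⌈12 * (j : ℝ) ^ (1 / 4 : ℝ) + 1⌉₊

/-- `Z_j = σ S_{L_j}` with `σ = sgn S_1`, for a trajectory `S` and times `L`. -/
def Zpos (S : ℕ → ℝ) (L : ℕ → ℕ) (j : ℕ) : ℝ := Real.sign (S 1) * S (L j)

/-- `N_j = L_j - u(S_{L_j})`, with `u` the initial potential. -/
def Njump (u : ℝ → ℝ) (S : ℕ → ℝ) (L : ℕ → ℕ) (j : ℕ) : ℝ := (L j : ℝ) - u (S (L j))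

/-- `Q_j = L_{j+1} - L_j`, an integer. -/
def Qlen (L : ℕ → ℕ) (j : ℕ) : ℤ := (L (j + 1) : ℤ) - (L j : ℤ)

/-- `X_j = Z_{j+1} - Z_j`. -/
def Xdisp (S : ℕ → ℝ) (L : ℕ → ℕ) (j : ℕ) : ℝ := Zpos S L (j + 1) - Zpos S L j

/-- The requirements on block `j ≥ 1`, for a trajectory `S` and times `L`. -/
def GoodBlock (ε : ℝ) (u : ℝ → ℝ) (S : ℕ → ℝ) (L : ℕ → ℕ) (j : ℕ) : Prop :=
  (Qlen L j = (blockLen j : ℤ) ∨ Qlen L j = (blockLen j : ℤ) + 1) ∧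
  ((1 - ε) * (((blockLen j : ℝ) - 1) / Njump u S L (j + 1)) ≤ Xdisp S L j ∧
    Xdisp S L j ≤ (1 + ε) * ((blockLen j : ℝ) / Njump u S L j)) ∧
  ∀ n : ℕ, L j ≤ n → n < L (j + 1) →
    Zpos S L (j - 1) < Real.sign (S 1) * S n ∧ Real.sign (S 1) * S n < Zpos S L (j + 1)

end

end GreedyWalk

/-! The stopping times can be taken deterministic: `blockTime j`, the sum of the first `j` block
lengths, so that always $Q_j=\ell_j$. What remains is to find an event of probability bounded below,
uniformly in $u$, on which the walk keeps escaping in the direction of its first step.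

Say this direction is right, and let $R_n$ (`reach`) be the right end of the last raised interval.
As long as the walk escapes, the potential beyond $R_n$ is still $u\le 0$, so the gap to the right
of the walk is at least $n$. The gap to the left is at most the number of steps since the walk
passed the left end of the new interval, and this number is of order $n^{1/10}$. So a step to the
left has probability of order at most $n^{-9/10}$. This is not summable, and such steps must be
tolerated. Two of them within distance $n^{1/4}$, or one followed by a very small $E$, do have
summable probabilities, and so does one at the end of a block: block $j$ ends at a time of order
$j^{5/4}$, which gives $j^{-9/8}$. An isolated step to the left is harmless, since the next interval
already reaches beyond $R_n$ and the walk returns to the right end.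

With $D_n=n-u(R_n)$ (`depth`), comparison of areas gives $(R_{n+1}-R_n)D_n\le E_n$ always, and
$E_n\le(1+\eta)D_{n+1}(R_{n+1}-R_n)$ when the walk is at the right end. As $D_n$ increases, these
sum over a block to the two bounds on $X_j$, once the block sums of the $E_n$ are controlled by
exponential moments.

The induction along the trajectory is `stage` (with `stage_front`, `stage_back` and `window_le`),
and `goodBlock` reads off the conclusion. For the probability, `exists_half_le_measure_tailEvent`
handles times from some `blockTime j₀` on by a union bound. Before that, finitely many driving
variables are confined to fixed sets (`headEvent`), independently of the tail. Only the favoured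
side depends on $u$; it is a function of $E_0$, and both sides cost the same. -/

namespace GreedyWalk

/-! ### Unimodal functions, areas and the radius. -/

/-- `v` is unimodal, with its strict maximum `h` at `s`. -/
structure UnimodalAt (v : ℝ → ℝ) (s h : ℝ) : Prop where
  eq_height : v s = h
  lt_height : ∀ y, y ≠ s → v y < h
  mono : MonotoneOn v (Set.Iic s)
  anti : AntitoneOn v (Set.Ici s)

namespace UnimodalAt

variable {v : ℝ → ℝ} {s h : ℝ}

lemma le_height (H : UnimodalAt v s h) (y : ℝ) : v y ≤ h := by
  by_cases hy : y = s
  · rw [hy, H.eq_height]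
  · exact (H.lt_height y hy).le

lemma peak_eq (H : UnimodalAt v s h) : peak v = s := by
  by_contra hne
  have h1 : ∀ y, v y ≤ v (peak v) :=
    Classical.epsilon_spec (p := fun x : ℝ => ∀ y : ℝ, v y ≤ v x)
      ⟨s, fun y => H.eq_height.symm ▸ H.le_height y⟩
  have h2 := h1 s
  rw [H.eq_height] at h2
  exact absurd (H.lt_height _ hne) (not_lt.mpr h2)

lemma height_eq (H : UnimodalAt v s h) : height v = h := by
  rw [height, H.peak_eq, H.eq_height]

lemma monotone_left (H : UnimodalAt v s h) : Monotone fun x => v (min x s) :=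
  fun _ _ hab => H.mono (Set.mem_Iic.2 (min_le_right _ _)) (Set.mem_Iic.2 (min_le_right _ _))
    (min_le_min_right _ hab)

lemma antitone_right (H : UnimodalAt v s h) : Antitone fun x => v (max x s) :=
  fun _ _ hab => H.anti (Set.mem_Ici.2 (le_max_right _ _)) (Set.mem_Ici.2 (le_max_right _ _))
    (max_le_max_right _ hab)

/-- A monotone plus an antitone function: measurability and integrability follow without any use of
continuity. -/
lemma eq_add (H : UnimodalAt v s h) : v = fun x => v (min x s) + v (max x s) - h := by
  funext x
  rcases le_total x s with hx | hx
  · rw [min_eq_left hx, max_eq_right hx, H.eq_height]; ring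
  · rw [min_eq_right hx, max_eq_left hx, H.eq_height]; ring

lemma measurable (H : UnimodalAt v s h) : Measurable v := by
  rw [H.eq_add]
  exact (H.monotone_left.measurable.add H.antitone_right.measurable).sub_const _

lemma intervalIntegrable (H : UnimodalAt v s h) (a b : ℝ) :
    IntervalIntegrable (fun x => h - v x) volume a b := by
  refine intervalIntegrable_const.sub ?_
  rw [H.eq_add]
  exact (H.monotone_left.intervalIntegrable.add H.antitone_right.intervalIntegrable).sub
    intervalIntegrable_const

/-- The area between the level `h` and the graph, over the interval of radius `z`. -/
lemma area_split (H : UnimodalAt v s h) (z : ℝ) :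
    ∫ x in (s - z)..(s + z), (h - v x)
      = (∫ x in (s - z)..s, (h - v x)) + ∫ x in s..(s + z), (h - v x) :=
  (intervalIntegral.integral_add_adjacent_intervals (H.intervalIntegrable _ _)
    (H.intervalIntegrable _ _)).symm

lemma integral_nonneg (H : UnimodalAt v s h) {a b : ℝ} (hab : a ≤ b) :
    0 ≤ ∫ x in a..b, (h - v x) :=
  intervalIntegral.integral_nonneg hab fun x _ => sub_nonneg.2 (H.le_height x)

lemma mul_le_area (H : UnimodalAt v s h) {z c d k : ℝ} (hc : s - z ≤ c) (hcd : c ≤ d)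
    (hd : d ≤ s + z) (hk : ∀ x, c < x → x < d → k ≤ h - v x) :
    (d - c) * k ≤ ∫ x in (s - z)..(s + z), (h - v x) := by
  have e1 : ∫ x in (s - z)..(s + z), (h - v x)
      = (∫ x in (s - z)..c, (h - v x)) + (∫ x in c..d, (h - v x))
        + ∫ x in d..(s + z), (h - v x) := by
    rw [intervalIntegral.integral_add_adjacent_intervals (H.intervalIntegrable _ _)
      (H.intervalIntegrable _ _), intervalIntegral.integral_add_adjacent_intervals
      (H.intervalIntegrable _ _) (H.intervalIntegrable _ _)]
  have e2 : (d - c) * k ≤ ∫ x in c..d, (h - v x) := by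
    have : ∫ _ in c..d, k = (d - c) * k := by simp
    rw [← this]
    exact intervalIntegral.integral_mono_on_of_le_Ioo hcd intervalIntegrable_const
      (H.intervalIntegrable _ _) fun x hx => hk x hx.1 hx.2
  have := H.integral_nonneg hc
  have := H.integral_nonneg hd
  linarith

lemma area_le_mul (H : UnimodalAt v s h) {z : ℝ} (hz : 0 ≤ z) :
    ∫ x in (s - z)..(s + z), (h - v x) ≤ z * ((h - v (s - z)) + (h - v (s + z))) := by
  rw [H.area_split]
  have e1 : ∫ x in (s - z)..s, (h - v x) ≤ z * (h - v (s - z)) := by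
    have : ∫ _ in (s - z)..s, (h - v (s - z)) = z * (h - v (s - z)) := by
      rw [intervalIntegral.integral_const, smul_eq_mul]; ring
    rw [← this]
    refine intervalIntegral.integral_mono_on (by linarith) (H.intervalIntegrable _ _)
      intervalIntegrable_const fun x hx => ?_
    have := H.mono (Set.mem_Iic.2 (by linarith)) (Set.mem_Iic.2 hx.2) hx.1
    linarith
  have e2 : ∫ x in s..(s + z), (h - v x) ≤ z * (h - v (s + z)) := by
    have : ∫ _ in s..(s + z), (h - v (s + z)) = z * (h - v (s + z)) := by
      rw [intervalIntegral.integral_const, smul_eq_mul]; ring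
    rw [← this]
    refine intervalIntegral.integral_mono_on (by linarith) (H.intervalIntegrable _ _)
      intervalIntegrable_const fun x hx => ?_
    have := H.anti (Set.mem_Ici.2 hx.1) (Set.mem_Ici.2 (by linarith)) hx.2
    linarith
  linarith

lemma area_strictMono (H : UnimodalAt v s h) {z z' : ℝ} (hz : 0 ≤ z) (hzz : z < z') :
    ∫ x in (s - z)..(s + z), (h - v x) < ∫ x in (s - z')..(s + z'), (h - v x) := by
  have e1 : ∫ x in (s - z')..(s + z'), (h - v x)
      = (∫ x in (s - z')..(s - z), (h - v x)) + (∫ x in (s - z)..(s + z), (h - v x))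
        + ∫ x in (s + z)..(s + z'), (h - v x) := by
    rw [intervalIntegral.integral_add_adjacent_intervals (H.intervalIntegrable _ _)
      (H.intervalIntegrable _ _), intervalIntegral.integral_add_adjacent_intervals
      (H.intervalIntegrable _ _) (H.intervalIntegrable _ _)]
  have e2 : 0 < ∫ x in (s + z)..(s + z'), (h - v x) :=
    intervalIntegral.intervalIntegral_pos_of_pos_on (H.intervalIntegrable _ _)
      (fun x hx => sub_pos.2 (H.lt_height x (by have := hx.1; intro h; linarith))) (by linarith)
  have := H.integral_nonneg (show s - z' ≤ s - z by linarith)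
  linarith

lemma area_continuous (H : UnimodalAt v s h) :
    Continuous fun z => ∫ x in (s - z)..(s + z), (h - v x) := by
  have hc := intervalIntegral.continuous_primitive (fun a b => H.intervalIntegrable a b) s
  have : (fun z => ∫ x in (s - z)..(s + z), (h - v x))
      = fun z => (∫ x in s..(s + z), (h - v x)) - ∫ x in s..(s - z), (h - v x) := by
    funext z
    rw [intervalIntegral.integral_interval_sub_left (H.intervalIntegrable _ _)
      (H.intervalIntegrable _ _)]
  rw [this]
  exact (hc.comp (continuous_const.add continuous_id)).sub
    (hc.comp (continuous_const.sub continuous_id))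

lemma exists_radius (H : UnimodalAt v s h) {e : ℝ} (he : 0 < e) :
    ∃ z, 0 < z ∧ ∫ x in (s - z)..(s + z), (h - v x) = e := by
  -- The depth is at least `d` to the right of `s + 1`, so a further length `e / d` already
  -- contributes area `e`.
  set d := h - v (s + 1) with hd
  have hd0 : 0 < d := sub_pos.2 (H.lt_height _ (by linarith))
  set Z := 1 + e / d
  have hZ : 0 < e / d := by positivity
  have hbig : e ≤ ∫ x in (s - Z)..(s + Z), (h - v x) := by
    have := H.mul_le_area (z := Z) (c := s + 1) (d := s + Z) (k := d) (by simp only [Z]; linarith)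
      (by simp only [Z]; linarith) le_rfl (fun x hx _ => by
        have := H.anti (Set.mem_Ici.2 (by linarith)) (Set.mem_Ici.2 (by linarith)) hx.le
        linarith)
    have e1 : (s + Z - (s + 1)) * d = e := by simp only [Z]; field_simp; ring
    linarith
  have h0 : ∫ x in (s - 0)..(s + 0), (h - v x) = 0 := by simp
  obtain ⟨z, hz, hze⟩ := intermediate_value_Icc (show (0 : ℝ) ≤ Z by positivity)
    H.area_continuous.continuousOn (show e ∈ Set.Icc _ _ from ⟨by simpa using he.le, hbig⟩)
  refine ⟨z, lt_of_le_of_ne hz.1 ?_, hze⟩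
  rintro rfl
  simp only at hze
  linarith

lemma area_injOn (H : UnimodalAt v s h) {z z' : ℝ} (hz : 0 < z) (hz' : 0 < z')
    (heq : ∫ x in (s - z)..(s + z), (h - v x) = ∫ x in (s - z')..(s + z'), (h - v x)) :
    z = z' := by
  rcases lt_trichotomy z z' with hl | hl | hl
  · exact absurd heq (H.area_strictMono hz.le hl).ne
  · exact hl
  · exact absurd heq (H.area_strictMono hz'.le hl).ne'

lemma radius_eq (H : UnimodalAt v s h) {e z : ℝ} (hz : 0 < z)
    (hze : ∫ x in (s - z)..(s + z), (h - v x) = e) : radius e v = z := by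
  have : {z : ℝ | 0 < z ∧ ∫ x in (peak v - z)..(peak v + z), (height v - v x) = e} = {z} := by
    ext z'
    simp only [H.peak_eq, H.height_eq, Set.mem_ofPred_eq, Set.mem_singleton_iff]
    constructor
    · rintro ⟨h1, h2⟩
      exact H.area_injOn h1 hz (h2.trans hze.symm)
    · rintro rfl
      exact ⟨hz, hze⟩
  rw [radius, this, csInf_singleton]

lemma radius_spec (H : UnimodalAt v s h) {e : ℝ} (he : 0 < e) :
    0 < radius e v ∧ ∫ x in (s - radius e v)..(s + radius e v), (h - v x) = e := by
  obtain ⟨z, hz, hze⟩ := H.exists_radius he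
  rw [H.radius_eq hz hze]
  exact ⟨hz, hze⟩

/-- The infimum of the empty set is `0`. This default value makes the radius monotone on all of `ℝ`,
hence measurable. -/
lemma radius_of_nonpos (H : UnimodalAt v s h) {e : ℝ} (he : e ≤ 0) : radius e v = 0 := by
  have : {z : ℝ | 0 < z ∧ ∫ x in (peak v - z)..(peak v + z), (height v - v x) = e} = ∅ := by
    refine Set.eq_empty_of_forall_notMem ?_
    rintro z ⟨hz, hze⟩
    rw [H.peak_eq, H.height_eq] at hze
    have := H.area_strictMono le_rfl hz
    simp only [sub_zero, add_zero, intervalIntegral.integral_same] at this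
    linarith
  rw [radius, this, Real.sInf_empty]

lemma radius_monotone (H : UnimodalAt v s h) : Monotone fun e => radius e v := by
  intro e e' hee
  rcases le_or_gt e 0 with he | he
  · simp only [H.radius_of_nonpos he]
    rcases le_or_gt e' 0 with he' | he'
    · rw [H.radius_of_nonpos he']
    · exact (H.radius_spec he').1.le
  · by_contra! hlt
    obtain ⟨h1, h2⟩ := H.radius_spec he
    obtain ⟨h3, h4⟩ := H.radius_spec (he.trans_le hee)
    have := H.area_strictMono h3.le hlt
    rw [h2, h4] at this
    linarith

lemma reflect (H : UnimodalAt v s h) : UnimodalAt (fun x => v (-x)) (-s) h where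
  eq_height := by simp [H.eq_height]
  lt_height y hy := H.lt_height _ fun h => hy (by linarith)
  mono a ha b hb hab := H.anti (Set.mem_Ici.2 (by linarith [Set.mem_Iic.1 hb]))
    (Set.mem_Ici.2 (by linarith [Set.mem_Iic.1 ha])) (by linarith)
  anti a ha b hb hab := H.mono (Set.mem_Iic.2 (by linarith [Set.mem_Ici.1 hb]))
    (Set.mem_Iic.2 (by linarith [Set.mem_Ici.1 ha])) (by linarith)

/-- Raising the interval of radius `z` to the level `h`, and one of its ends to `h + 1`, keeps
the potential unimodal. -/
lemma raise (H : UnimodalAt v s h) {z t : ℝ} (hz : 0 ≤ z) (ht : t = s - z ∨ t = s + z)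
    {v' : ℝ → ℝ} (hpt : v' t = h + 1)
    (hin : ∀ y ∈ Set.Icc (s - z) (s + z), y ≠ t → v' y = h)
    (hout : ∀ y ∉ Set.Icc (s - z) (s + z), v' y = v y) : UnimodalAt v' t (h + 1) := by
  have hle : ∀ y, y ≠ t → v' y ≤ h := fun y hy => by
    by_cases hm : y ∈ Set.Icc (s - z) (s + z)
    · exact (hin y hm hy).le
    · rw [hout y hm]; exact H.le_height y
  refine ⟨hpt, fun y hy => by linarith [hle y hy], fun a ha b hb hab => ?_,
    fun a ha b hb hab => ?_⟩
  · rw [Set.mem_Iic] at ha hb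
    by_cases hbt : b = t
    · by_cases hat : a = t
      · rw [hbt, hat]
      · rw [hbt, hpt]; linarith [hle a hat]
    have hbt' : b < t := lt_of_le_of_ne hb hbt
    have hat : a ≠ t := (hab.trans_lt hbt').ne
    by_cases hbm : b ∈ Set.Icc (s - z) (s + z)
    · rw [hin b hbm hbt]; exact hle a hat
    · have hbs : b < s - z := by
        by_contra! hge
        exact hbm ⟨hge, by rcases ht with ht | ht <;> linarith⟩
      rw [hout b hbm, hout a fun hm => by linarith [hm.1]]
      exact H.mono (Set.mem_Iic.2 (by linarith)) (Set.mem_Iic.2 (by linarith)) hab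
  · rw [Set.mem_Ici] at ha hb
    by_cases hat : a = t
    · by_cases hbt : b = t
      · rw [hbt, hat]
      · rw [hat, hpt]; linarith [hle b hbt]
    have hat' : t < a := lt_of_le_of_ne ha (Ne.symm hat)
    have hbt : b ≠ t := (hat'.trans_le hab).ne'
    by_cases ham : a ∈ Set.Icc (s - z) (s + z)
    · rw [hin a ham hat]; exact hle b hbt
    · have hsa : s + z < a := by
        by_contra! hge
        exact ham ⟨by rcases ht with ht | ht <;> linarith, hge⟩
      rw [hout a ham, hout b fun hm => by linarith [hm.2]]
      exact H.anti (Set.mem_Ici.2 (by linarith)) (Set.mem_Ici.2 (by linarith)) hab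

end UnimodalAt

lemma IsPotential.unimodalAt {u : ℝ → ℝ} (hp : IsPotential u) (hc : IsCentered u)
    (hu : IsUnimodal u) : UnimodalAt u 0 0 := by
  obtain ⟨hc1, hc2⟩ := hc
  obtain ⟨-, x, hx, hun⟩ := hp
  have hx0 : x = 0 := by
    rw [← hc1]
    exact (hun _ (Classical.epsilon_spec (p := fun x : ℝ => ∀ y : ℝ, u y ≤ u x) ⟨x, hx⟩)).symm
  subst hx0
  have h0 : u 0 = 0 := by rw [height, hc1] at hc2; exact hc2
  rw [IsUnimodal, hc1] at hu
  refine ⟨h0, fun y hy => ?_, fun a ha b hb hab => ?_, fun a ha b hb hab => ?_⟩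
  · refine lt_of_le_of_ne (h0 ▸ hx y) fun heq => hy (hun y fun y' => ?_)
    rw [heq, ← h0]; exact hx y'
  · rcases (Set.mem_Iic.1 hb).eq_or_lt with rfl | hb'
    · exact hx a
    · exact hu.1 (hab.trans_lt hb') hb' hab
  · rcases (Set.mem_Ici.1 ha).eq_or_lt with rfl | ha'
    · exact hx b
    · exact hu.2 ha' (ha'.trans_le hab) hab

/-! ### Trajectories, gaps and levels. -/

/-- A sequence of unimodal functions `v n` with peaks `S n`, produced from `u` by the steps of the
greedy walk with radii `z n` and areas `E n`, irrespective of how the directions are chosen. -/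
structure Trajectory (u : ℝ → ℝ) (E S z : ℕ → ℝ) (v : ℕ → ℝ → ℝ) : Prop where
  init : v 0 = u
  start : S 0 = 0
  unimodal : ∀ n : ℕ, UnimodalAt (v n) (S n) n
  radius_pos : ∀ n, 0 < z n
  area : ∀ n : ℕ, ∫ x in (S n - z n)..(S n + z n), ((n : ℝ) - v n x) = E n
  step : ∀ n, S (n + 1) = S n - z n ∨ S (n + 1) = S n + z n
  inside : ∀ (n : ℕ) (y : ℝ), y ∈ Set.Icc (S n - z n) (S n + z n) → y ≠ S (n + 1) →
    v (n + 1) y = n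
  outside : ∀ (n : ℕ) (y : ℝ), y ∉ Set.Icc (S n - z n) (S n + z n) → v (n + 1) y = v n y

/-- The depth of the potential at the left candidate for the next position. -/
def leftGap (S z : ℕ → ℝ) (v : ℕ → ℝ → ℝ) (n : ℕ) : ℝ := n - v n (S n - z n)

/-- The depth of the potential at the right candidate for the next position. -/
def rightGap (S z : ℕ → ℝ) (v : ℕ → ℝ → ℝ) (n : ℕ) : ℝ := n - v n (S n + z n)

/-- The right end of the last interval that was raised. -/
def reach (S z : ℕ → ℝ) : ℕ → ℝ
  | 0 => 0
  | n + 1 => S n + z n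

/-- The depth, at time `n`, of the initial potential at the point `reach S z n`. -/
def depth (u : ℝ → ℝ) (S z : ℕ → ℝ) (n : ℕ) : ℝ := n - u (reach S z n)

namespace Trajectory

variable {u : ℝ → ℝ} {E S z : ℕ → ℝ} {v : ℕ → ℝ → ℝ}

/-- The rule for the direction of a step is not part of `Trajectory`, so the notion is symmetric and
only walks that start to the right need analysis. -/
lemma reflect (T : Trajectory u E S z v) :
    Trajectory (fun x => u (-x)) E (fun n => -S n) z (fun n x => v n (-x)) where
  init := by rw [T.init]
  start := by simp [T.start]
  unimodal n := (T.unimodal n).reflect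
  radius_pos := T.radius_pos
  area n := by
    rw [← T.area n, intervalIntegral.integral_comp_neg (fun x => (n : ℝ) - v n x)]
    congr 1 <;> ring
  step n := (T.step n).symm.imp (fun h => by rw [h]; ring) (fun h => by rw [h]; ring)
  inside n y hy hne := T.inside n (-y) ⟨by linarith [hy.2], by linarith [hy.1]⟩
    fun h => hne (by linarith)
  outside n y hy := T.outside n (-y) fun h => hy ⟨by linarith [h.2], by linarith [h.1]⟩

lemma leftGap_reflect (n : ℕ) :
    leftGap (fun n => -S n) z (fun n x => v n (-x)) n = rightGap S z v n := by
  simp only [leftGap, rightGap]; congr 2; ring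

lemma rightGap_reflect (n : ℕ) :
    rightGap (fun n => -S n) z (fun n x => v n (-x)) n = leftGap S z v n := by
  simp only [leftGap, rightGap]; congr 2; ring

lemma unimodal_init (T : Trajectory u E S z v) : UnimodalAt u 0 0 := by
  have := T.unimodal 0
  rwa [T.init, T.start, Nat.cast_zero] at this

lemma le_succ (T : Trajectory u E S z v) (n : ℕ) (y : ℝ) : v n y ≤ v (n + 1) y := by
  by_cases hm : y ∈ Set.Icc (S n - z n) (S n + z n)
  · have h1 := (T.unimodal n).le_height y
    by_cases hy : y = S (n + 1)
    · have := (T.unimodal (n + 1)).eq_height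
      rw [hy, this]; rw [hy] at h1; push_cast; linarith
    · rw [T.inside n y hm hy]; exact h1
  · exact (T.outside n y hm).ge

lemma monotone (T : Trajectory u E S z v) (y : ℝ) : Monotone fun n => v n y :=
  monotone_nat_of_le_succ fun n => T.le_succ n y

/-- The potential had value `k` at `S k` at time `k` and never decreases in time; unimodality
spreads this value up to the present peak. -/
lemma level_le (T : Trajectory u E S z v) {k n : ℕ} {y : ℝ} (hkn : k ≤ n) (h1 : S k ≤ y)
    (h2 : y ≤ S n) : (k : ℝ) ≤ v n y := by
  have e1 := (T.unimodal n).mono (Set.mem_Iic.2 (h1.trans h2)) (Set.mem_Iic.2 h2) h1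
  have e2 := T.monotone (S k) hkn
  simp only [(T.unimodal k).eq_height] at e2
  linarith

lemma le_inside (T : Trajectory u E S z v) {n : ℕ} {y : ℝ}
    (hy : y ∈ Set.Icc (S n - z n) (S n + z n)) : (n : ℝ) ≤ v (n + 1) y := by
  by_cases h : y = S (n + 1)
  · rw [h, (T.unimodal (n + 1)).eq_height]; push_cast; linarith
  · exact (T.inside n y hy h).ge

lemma level_le_succ (T : Trajectory u E S z v) {n : ℕ} {y : ℝ} (h1 : S n - z n ≤ y)
    (h2 : y ≤ S (n + 1)) : (n : ℝ) ≤ v (n + 1) y := by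
  have hz := T.radius_pos n
  have e1 := (T.unimodal (n + 1)).mono (Set.mem_Iic.2 (h1.trans h2)) (Set.mem_Iic.2 h2) h1
  have e2 := T.le_inside (n := n) (y := S n - z n) ⟨le_rfl, by linarith⟩
  linarith

lemma leftGap_nonneg (T : Trajectory u E S z v) (n : ℕ) : 0 ≤ leftGap S z v n :=
  sub_nonneg.2 ((T.unimodal n).le_height _)

lemma rightGap_nonneg (T : Trajectory u E S z v) (n : ℕ) : 0 ≤ rightGap S z v n :=
  sub_nonneg.2 ((T.unimodal n).le_height _)

lemma leftGap_pos (T : Trajectory u E S z v) (n : ℕ) : 0 < leftGap S z v n :=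
  sub_pos.2 ((T.unimodal n).lt_height _ (by linarith [T.radius_pos n]))

lemma rightGap_pos (T : Trajectory u E S z v) (n : ℕ) : 0 < rightGap S z v n :=
  sub_pos.2 ((T.unimodal n).lt_height _ (by linarith [T.radius_pos n]))

lemma area_le (T : Trajectory u E S z v) (n : ℕ) :
    E n ≤ z n * (leftGap S z v n + rightGap S z v n) := by
  rw [← T.area n]
  exact (T.unimodal n).area_le_mul (T.radius_pos n).le

lemma E_pos (T : Trajectory u E S z v) (n : ℕ) : 0 < E n := by
  rw [← T.area n]
  have := (T.unimodal n).area_strictMono le_rfl (T.radius_pos n)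
  simpa using this

lemma leftGap_le (T : Trajectory u E S z v) {k n : ℕ} (hkn : k ≤ n) (h : S k ≤ S n - z n) :
    leftGap S z v n ≤ n - k := by
  have := T.level_le hkn h (by linarith [T.radius_pos n])
  rw [leftGap]; linarith

/-- The left candidate lies in the interval just raised to level `n`, or between it and the peak,
while the maximum is now `n + 1`. -/
lemma leftGap_succ_le_one (T : Trajectory u E S z v) {n : ℕ}
    (h : S n - z n ≤ S (n + 1) - z (n + 1)) : leftGap S z v (n + 1) ≤ 1 := by
  have := T.level_le_succ h (by linarith [T.radius_pos (n + 1)])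
  rw [leftGap]; push_cast; linarith

lemma le_depth (T : Trajectory u E S z v) (n : ℕ) : (n : ℝ) ≤ depth u S z n := by
  have := T.unimodal_init.le_height (reach S z n)
  rw [depth]; linarith

end Trajectory

/-! ### Controlled trajectories and the invariant that they preserve. -/

/-- Relations between the deterministic thresholds that are used from time `n₀` on. -/
structure Calibrated (κ θ s : ℕ → ℝ) (w h : ℕ → ℕ) (η : ℝ) (n₀ : ℕ) : Prop where
  one_le : 1 ≤ n₀
  η_nonneg : 0 ≤ η
  η_le : η ≤ 1
  κ_mono : Monotone κ
  w_mono : Monotone w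
  two_le_κ : ∀ n, n₀ ≤ n → 2 ≤ κ n
  κ_succ : ∀ n, n₀ ≤ n → κ (n + 1) ≤ 2 * κ n
  w_lt : ∀ n, n₀ ≤ n → 2 * w n < n
  w_θ : ∀ n : ℕ, n₀ ≤ n → 2 * (w n : ℝ) + 1 ≤ θ n * n
  w_η : ∀ n : ℕ, n₀ ≤ n → 2 * (w n : ℝ) ≤ η * n
  s_ge : ∀ n : ℕ, n₀ ≤ n → 2 * κ n * (2 * w n + 2) ≤ s n * n
  w_le_h : ∀ b n : ℕ, n₀ ≤ b → b < n → n ≤ b + 2 * w n + 1 → 2 * w n ≤ h b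
  one_le_h : ∀ b, n₀ ≤ b → 1 ≤ h b

/-- A trajectory that starts to the right, and whose driving variables behave as is typical:
apart from isolated times that are `bad`, the walk steps to the right whenever this is much more
likely than a step to the left. -/
structure Controlled (u : ℝ → ℝ) (E S z : ℕ → ℝ) (v : ℕ → ℝ → ℝ) (bad : ℕ → Prop)
    (κ θ s : ℕ → ℝ) (w h : ℕ → ℕ) (n₀ : ℕ) : Prop extends Trajectory u E S z v where
  first : S 1 = S 0 + z 0
  first_gap : leftGap S z v 0 ≤ rightGap S z v 0
  two_le_E : 2 ≤ E 0
  E_head : ∀ n, 1 ≤ n → n < n₀ → 1 ≤ E n ∧ E n ≤ 2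
  fwd_head : ∀ n, 1 ≤ n → n < n₀ → leftGap S z v n ≤ rightGap S z v n → S (n + 1) = S n + z n
  bad_ge : ∀ n, bad n → n₀ ≤ n
  fwd_tail : ∀ n, n₀ ≤ n → ¬ bad n → leftGap S z v n ≤ θ n * rightGap S z v n →
    S (n + 1) = S n + z n
  E_le : ∀ n, n₀ ≤ n → E n ≤ κ n
  window : ∀ n, n₀ ≤ n → 11 * κ n ≤ ∑ i ∈ Finset.Ico (n - 2 * w n) n, E i
  isolated : ∀ b b', bad b → bad b' → b < b' → b + h b < b'
  after_bad : ∀ b, bad b → s b < E (b + 1)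

/-- The state of a controlled trajectory at time `n`. -/
structure Stage (u : ℝ → ℝ) (E S z : ℕ → ℝ) (v : ℕ → ℝ → ℝ) (bad : ℕ → Prop) (η : ℝ)
    (n₀ n : ℕ) : Prop where
  nonneg : 0 ≤ reach S z n
  beyond : ∀ y, reach S z n < y → v n y = u y
  pos : S n = reach S z n ∨
    ∃ m, n = m + 1 ∧ bad m ∧ S m = reach S z m ∧ S n = reach S z n - 2 * z m
  lt : reach S z n < reach S z (n + 1)
  upper : (reach S z (n + 1) - reach S z n) * depth u S z n ≤ E n
  lower : 1 ≤ n → S n = reach S z n →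
    E n ≤ (1 + η) * (depth u S z (n + 1) * (reach S z (n + 1) - reach S z n))
  lower_head : 1 ≤ n → n < n₀ →
    E n ≤ depth u S z (n + 1) * (reach S z (n + 1) - reach S z n)
  fwd : ¬ (bad n ∧ S n = reach S z n) → S (n + 1) = S n + z n

section Stage

variable {u : ℝ → ℝ} {E S z : ℕ → ℝ} {v : ℕ → ℝ → ℝ} {bad : ℕ → Prop} {κ θ s : ℕ → ℝ}
  {w h : ℕ → ℕ} {η : ℝ} {n₀ : ℕ}

lemma reach_le_of_stage {a b : ℕ} (hab : a ≤ b)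
    (hs : ∀ i, a ≤ i → i < b → Stage u E S z v bad η n₀ i) : reach S z a ≤ reach S z b := by
  induction b, hab using Nat.le_induction with
  | base => exact le_rfl
  | succ b hab ih =>
    exact (ih fun i h1 h2 => hs i h1 (by omega)).trans (hs b hab (by omega)).lt.le

lemma depth_le_of_reach (T : Trajectory u E S z v) {a b : ℕ}
    (ha : 0 ≤ reach S z a) (hr : reach S z a ≤ reach S z b) :
    depth u S z a + (b - a) ≤ depth u S z b := by
  have := T.unimodal_init.anti (Set.mem_Ici.2 ha) (Set.mem_Ici.2 (ha.trans hr)) hr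
  simp only [depth]; linarith

lemma depth_le_of_stage (T : Trajectory u E S z v) {a b : ℕ} (hab : a ≤ b)
    (hs : ∀ i, a ≤ i → i < b → Stage u E S z v bad η n₀ i) :
    depth u S z a ≤ depth u S z b := by
  rcases hab.eq_or_lt with rfl | hlt
  · exact le_rfl
  · have := depth_le_of_reach T (hs a le_rfl hlt).nonneg (reach_le_of_stage hab hs)
    have : (a : ℝ) ≤ b := by exact_mod_cast hab
    linarith

/-- The depth is smallest at time `a`, so the one-step bounds `Stage.upper` telescope. -/
lemma sum_upper (T : Trajectory u E S z v) {a b : ℕ} (hab : a ≤ b)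
    (hs : ∀ i, a ≤ i → i < b → Stage u E S z v bad η n₀ i) :
    (reach S z b - reach S z a) * depth u S z a ≤ ∑ i ∈ Finset.Ico a b, E i := by
  induction b, hab using Nat.le_induction with
  | base => simp
  | succ b hab ih =>
    rw [Finset.sum_Ico_succ_top hab]
    have h1 := ih fun i h1 h2 => hs i h1 (by omega)
    have h2 := hs b hab (by omega)
    have h3 := depth_le_of_stage T hab fun i h1 h2 => hs i h1 (by omega)
    have h4 := mul_le_mul_of_nonneg_left h3 (sub_nonneg.2 h2.lt.le)
    have h5 := h2.upper
    nlinarith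

-- Here the depth is largest at time `b`. The one-step lower bound is available only when the walk
-- is at the right end, so the other terms are replaced by `0`.
open Classical in
lemma sum_lower (T : Trajectory u E S z v) {c : ℝ} {a b : ℕ} (hc : 0 ≤ c) (hab : a ≤ b)
    (hs : ∀ i, a ≤ i → i < b → Stage u E S z v bad η n₀ i)
    (hlow : ∀ i, a ≤ i → i < b → S i = reach S z i →
      E i ≤ c * (depth u S z (i + 1) * (reach S z (i + 1) - reach S z i))) :
    ∑ i ∈ Finset.Ico a b, (if S i = reach S z i then E i else 0)
      ≤ c * (depth u S z b * (reach S z b - reach S z a)) := by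
  induction b, hab using Nat.le_induction with
  | base => simp
  | succ b hab ih =>
    rw [Finset.sum_Ico_succ_top hab]
    have h1 := ih (fun i h1 h2 => hs i h1 (by omega)) (fun i h1 h2 => hlow i h1 (by omega))
    have h2 := hs b hab (by omega)
    have h3 : depth u S z b ≤ depth u S z (b + 1) :=
      depth_le_of_stage T (Nat.le_succ b) fun i h1 h2 => hs i (by omega) (by omega)
    have h4 := reach_le_of_stage hab fun i h1 h2 => hs i h1 (by omega)
    have h5 : depth u S z b * (reach S z b - reach S z a)
        ≤ depth u S z (b + 1) * (reach S z b - reach S z a) :=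
      mul_le_mul_of_nonneg_right h3 (sub_nonneg.2 h4)
    have h6 : (if S b = reach S z b then E b else 0)
        ≤ c * (depth u S z (b + 1) * (reach S z (b + 1) - reach S z b)) := by
      split_ifs with hb
      · exact hlow b hab (by omega) hb
      · have := T.le_depth (b + 1)
        have : 0 ≤ depth u S z (b + 1) := (Nat.cast_nonneg _).trans this
        exact mul_nonneg hc (mul_nonneg this (sub_nonneg.2 h2.lt.le))
    have h7 := mul_le_mul_of_nonneg_left h5 hc
    have h8 : c * (depth u S z (b + 1) * (reach S z (b + 1) - reach S z a))
        = c * (depth u S z (b + 1) * (reach S z b - reach S z a))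
          + c * (depth u S z (b + 1) * (reach S z (b + 1) - reach S z b)) := by ring
    linarith

open Classical in
/-- At most one term is lost when the sum is restricted to the times at which the walk is at the
right end of the explored region. -/
lemma sum_sub_le {a b : ℕ} {c : ℝ} (hc : 0 ≤ c) (hE : ∀ i, S i ≠ reach S z i → a ≤ i → i < b →
      E i ≤ c) (hun : ∀ i i', S i ≠ reach S z i → S i' ≠ reach S z i' → a ≤ i → i < i' →
      i' < b → False) :
    ∑ i ∈ Finset.Ico a b, E i - c
      ≤ ∑ i ∈ Finset.Ico a b, (if S i = reach S z i then E i else 0) := by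
  rw [sub_le_comm, ← Finset.sum_sub_distrib]
  by_cases hex : ∃ i, S i ≠ reach S z i ∧ a ≤ i ∧ i < b
  · obtain ⟨i, hi, hai, hib⟩ := hex
    rw [Finset.sum_eq_single i]
    · rw [if_neg hi, sub_zero]; exact hE i hi hai hib
    · intro i' hi' hne
      rw [Finset.mem_Ico] at hi'
      by_cases h : S i' = reach S z i'
      · rw [if_pos h, sub_self]
      · rcases lt_or_gt_of_ne hne with hl | hl
        · exact (hun i' i h hi hi'.1 hl hib).elim
        · exact (hun i i' hi h hai hl hi'.2).elim
    · intro hn; exact absurd (Finset.mem_Ico.2 ⟨hai, hib⟩) hn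
  · push Not at hex
    rw [Finset.sum_eq_zero]
    · exact hc
    · intro i hi
      rw [Finset.mem_Ico] at hi
      by_cases h : S i = reach S z i
      · rw [if_pos h, sub_self]
      · exact absurd hi.2 (not_lt.2 (hex i h hi.1))

lemma Stage.exists_bad {n : ℕ} (H : Stage u E S z v bad η n₀ n) (hn : S n ≠ reach S z n) :
    ∃ m, n = m + 1 ∧ bad m ∧ S m = reach S z m ∧ S n = reach S z n - 2 * z m :=
  H.pos.resolve_left hn

/-- In units of `1 / depth`, the last `2 * w n` steps advance the reach by at least `5 * κ n`. The
window sum is at least `11 * κ n`; at most one term, of size at most `κ n`, is lost because bad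
times are isolated, and the factor `1 + η ≤ 2` turns the remaining `10` into `5`. A single interval
cannot stretch back that far, which bounds the left gap. -/
lemma window_le (C : Controlled u E S z v bad κ θ s w h n₀) (K : Calibrated κ θ s w h η n₀)
    {n : ℕ} (hn : n₀ ≤ n) (hs : ∀ i, i < n → Stage u E S z v bad η n₀ i) :
    5 * κ n ≤ depth u S z n * (reach S z n - reach S z (n - 2 * w n)) := by
  classical
  have hw := K.w_lt n hn
  set m := n - 2 * w n with hm
  have hκ := K.two_le_κ n hn
  have h1 := sum_lower (bad := bad) (η := η) (n₀ := n₀) C.toTrajectory (c := 1 + η)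
    (by linarith [K.η_nonneg]) (show m ≤ n by omega) (fun i _ h2 => hs i h2)
    (fun i h1 h2 h3 => (hs i h2).lower (by omega) h3)
  have h2 := sum_sub_le (E := E) (S := S) (z := z) (a := m) (b := n) (c := κ n) (by linarith)
    (fun i hi h1 h2 => by
      obtain ⟨b, rfl, hb, -⟩ := (hs i h2).exists_bad hi
      exact (C.E_le _ ((C.bad_ge b hb).trans (Nat.le_succ b))).trans (K.κ_mono h2.le))
    (fun i i' hi hi' h1 h2 h3 => by
      obtain ⟨b, rfl, hb, -⟩ := (hs i (h2.trans h3)).exists_bad hi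
      obtain ⟨b', rfl, hb', -⟩ := (hs i' h3).exists_bad hi'
      have e1 := C.isolated b b' hb hb' (by omega)
      have e2 := K.w_le_h b n (C.bad_ge b hb) (by omega) (by omega)
      omega)
  have h3 := C.window n hn
  have h4 := K.η_le
  have h5 : 0 ≤ depth u S z n * (reach S z n - reach S z m) :=
    mul_nonneg ((Nat.cast_nonneg _).trans (C.le_depth n))
      (sub_nonneg.2 (reach_le_of_stage (by omega) fun i _ h2 => hs i h2))
  nlinarith

lemma Stage.le_reach (T : Trajectory u E S z v) {n : ℕ} (H : Stage u E S z v bad η n₀ n) :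
    S n ≤ reach S z n := by
  rcases H.pos with h | ⟨m, -, -, -, h⟩
  · exact h.le
  · linarith [T.radius_pos m]

lemma stage_zero (C : Controlled u E S z v bad κ θ s w h n₀) :
    Stage u E S z v bad η n₀ 0 where
  nonneg := le_rfl
  beyond y _ := by rw [C.init]
  pos := Or.inl C.start
  lt := by simp only [reach, C.start]; linarith [C.radius_pos 0]
  upper := by
    have : depth u S z 0 = 0 := by
      have := C.unimodal_init.eq_height
      simp [depth, reach, this]
    rw [this, mul_zero]; exact (C.E_pos 0).le
  lower h := absurd h (by norm_num)
  lower_head h := absurd h (by norm_num)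
  fwd _ := C.first

/-- The bound on the left gap that holds while the walk is at the right end of the explored
region. -/
lemma leftGap_front (C : Controlled u E S z v bad κ θ s w h n₀) (K : Calibrated κ θ s w h η n₀)
    {n : ℕ} (hs : ∀ i, i < n + 1 → Stage u E S z v bad η n₀ i)
    (hfr : S (n + 1) = reach S z (n + 1))
    (hup : z (n + 1) * depth u S z (n + 1) ≤ E (n + 1)) :
    (n + 1 < n₀ → leftGap S z v (n + 1) ≤ 1) ∧
      (n₀ ≤ n + 1 → leftGap S z v (n + 1) ≤ 2 * w (n + 1)) := by
  have hR : 0 < depth u S z (n + 1) :=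
    lt_of_lt_of_le (by positivity) (C.le_depth (n + 1))
  refine ⟨fun hlt => ?_, fun hge => ?_⟩
  · apply C.leftGap_succ_le_one
    -- For `n = 0` the area is at most twice `z 0` times the right gap, hence the requirement `2 ≤ E
    -- 0`. Together with `E (n + 1) ≤ 2` this yields `z (n + 1) ≤ 2 * z n`: the new interval does
    -- not extend to the left of the previous one.
    have e1 : 1 ≤ z n * depth u S z (n + 1) := by
      rcases Nat.eq_zero_or_pos n with rfl | hpos
      · have h1 := C.area_le 0
        have h2 := C.first_gap
        have h3 : rightGap S z v 0 ≤ depth u S z (0 + 1) := by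
          simp only [rightGap, depth, reach, C.init]; push_cast; linarith
        have h4 := C.two_le_E
        have h5 := C.radius_pos 0
        nlinarith
      · have h1 := (hs n (by omega)).lower_head hpos (by omega)
        have h2 := (C.E_head n hpos (by omega)).1
        have h3 : S n = reach S z n := by
          by_contra hne
          obtain ⟨m, rfl, hm, -⟩ := (hs n (by omega)).exists_bad hne
          have := C.bad_ge m hm
          omega
        have h4 : reach S z (n + 1) - reach S z n = z n := by rw [← h3]; simp [reach]
        rw [h4] at h1
        linarith
    have e2 := (C.E_head (n + 1) (by omega) hlt).2
    have e3 : z (n + 1) ≤ 2 * z n := by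
      by_contra! hcon
      have := mul_lt_mul_of_pos_right hcon hR
      linarith
    rw [hfr]
    simp only [reach]
    linarith
  · have hwin := window_le C K hge hs
    have hw := K.w_lt (n + 1) hge
    have hκ := K.two_le_κ _ hge
    have hm : S (n + 1 - 2 * w (n + 1)) ≤ S (n + 1) - z (n + 1) := by
      by_cases hw0 : w (n + 1) = 0
      · simp only [hw0, mul_zero, Nat.sub_zero, sub_self] at hwin
        linarith
      have h1 := (hs (n + 1 - 2 * w (n + 1)) (by omega)).le_reach C.toTrajectory
      have h2 := C.E_le _ hge
      by_contra! hcon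
      have h3 : reach S z (n + 1) - reach S z (n + 1 - 2 * w (n + 1)) < z (n + 1) := by linarith
      have := mul_lt_mul_of_pos_right h3 hR
      linarith
    have := C.leftGap_le (Nat.sub_le _ _) hm
    rw [Nat.cast_sub hw.le] at this
    push_cast at this ⊢
    linarith

/-- The walk is at the right end: the potential to its right is still `u`, which gives the upper
bound on the advance. The left gap is negligible against the right one, which gives the lower bound
and, outside bad times, the next direction. -/
lemma stage_front (C : Controlled u E S z v bad κ θ s w h n₀) (K : Calibrated κ θ s w h η n₀)
    {n : ℕ} (hs : ∀ i, i < n + 1 → Stage u E S z v bad η n₀ i)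
    (hnn : 0 ≤ reach S z (n + 1)) (hbey : ∀ y, reach S z (n + 1) < y → v (n + 1) y = u y)
    (hfr : S (n + 1) = reach S z (n + 1)) : Stage u E S z v bad η n₀ (n + 1) := by
  have hz := C.radius_pos (n + 1)
  have hreach : reach S z (n + 1 + 1) = reach S z (n + 1) + z (n + 1) := by
    rw [← hfr]; rfl
  have hup : z (n + 1) * depth u S z (n + 1) ≤ E (n + 1) := by
    rw [← C.area (n + 1)]
    have := (C.unimodal (n + 1)).mul_le_area (z := z (n + 1)) (c := S (n + 1))
      (d := S (n + 1) + z (n + 1)) (k := depth u S z (n + 1)) (by linarith) (by linarith) le_rfl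
      fun x hx _ => by
        rw [hfr] at hx
        rw [hbey x hx, depth]
        have := C.unimodal_init.anti (Set.mem_Ici.2 hnn) (Set.mem_Ici.2 (hnn.trans hx.le)) hx.le
        linarith
    simpa using this
  -- The depth on the right is taken one time unit later. The `1` thus gained absorbs the left gap
  -- before `n₀`, where the lower bound needs no factor `1 + η`.
  have hB : rightGap S z v (n + 1) = depth u S z (n + 1 + 1) - 1 := by
    have : S (n + 1) + z (n + 1) = reach S z (n + 1 + 1) := rfl
    rw [rightGap, this, hbey _ (by linarith), depth]
    push_cast; ring
  have hB1 : ((n + 1 : ℕ) : ℝ) ≤ rightGap S z v (n + 1) := by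
    have := C.le_depth (n + 1 + 1)
    rw [hB]; push_cast at this ⊢; linarith
  have hn1 : (1 : ℝ) ≤ ((n + 1 : ℕ) : ℝ) := by push_cast; linarith [Nat.cast_nonneg (α := ℝ) n]
  obtain ⟨hA1, hA2⟩ := leftGap_front C K hs hfr hup
  have harea := C.area_le (n + 1)
  have hlow1 : n + 1 < n₀ → E (n + 1)
      ≤ depth u S z (n + 1 + 1) * (reach S z (n + 1 + 1) - reach S z (n + 1)) := fun hlt => by
    have := hA1 hlt
    rw [hreach, add_sub_cancel_left]
    nlinarith
  have hη := K.η_nonneg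
  refine ⟨hnn, hbey, Or.inl hfr, by linarith, by rwa [hreach, add_sub_cancel_left],
    fun _ _ => ?_, fun _ => hlow1, fun hbad => ?_⟩
  · rcases lt_or_ge (n + 1) n₀ with hlt | hge
    · have h1 := hlow1 hlt
      have h2 := C.E_pos (n + 1)
      nlinarith
    · have h1 := hA2 hge
      have h2 := K.w_η _ hge
      rw [hreach, add_sub_cancel_left]
      have h3 : leftGap S z v (n + 1) + rightGap S z v (n + 1)
          ≤ (1 + η) * depth u S z (n + 1 + 1) := by
        nlinarith
      have h4 := mul_le_mul_of_nonneg_left h3 hz.le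
      linarith
  · rcases lt_or_ge (n + 1) n₀ with hlt | hge
    · exact C.fwd_head _ (by omega) hlt (by linarith [hA1 hlt])
    · refine C.fwd_tail _ hge (fun hb => hbad ⟨hb, hfr⟩) ?_
      have h1 := hA2 hge
      have h2 := K.w_θ _ hge
      have h3 : 0 ≤ θ (n + 1) := by
        by_contra! hneg
        have : (0 : ℝ) ≤ w (n + 1) := Nat.cast_nonneg _
        nlinarith
      have h4 := mul_le_mul_of_nonneg_left hB1 h3
      linarith

/-- The walk has just stepped left at a bad time `n`, to the left end of the raised interval. The
next interval must cover that one and extend beyond it; the step is then to the right, because `n +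
1` is not bad. -/
lemma stage_back (C : Controlled u E S z v bad κ θ s w h n₀) (K : Calibrated κ θ s w h η n₀)
    {n : ℕ} (hs : ∀ i, i < n + 1 → Stage u E S z v bad η n₀ i)
    (hnn : 0 ≤ reach S z (n + 1)) (hbey : ∀ y, reach S z (n + 1) < y → v (n + 1) y = u y)
    (hbad : bad n) (hfr : S n = reach S z n) (hbk : S (n + 1) = reach S z (n + 1) - 2 * z n) :
    Stage u E S z v bad η n₀ (n + 1) := by
  have hz := C.radius_pos n
  have hz1 := C.radius_pos (n + 1)
  have hn0 := C.bad_ge n hbad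
  have hn1 : 1 ≤ n := K.one_le.trans hn0
  have hR : 0 < depth u S z n := lt_of_lt_of_le (by exact_mod_cast hn1) (C.le_depth n)
  have hreach : reach S z (n + 1) = reach S z n + z n := by rw [← hfr]; rfl
  have hreach2 : reach S z (n + 1 + 1) = S (n + 1) + z (n + 1) := rfl
  have hdep : depth u S z n ≤ depth u S z (n + 1) :=
    depth_le_of_stage C.toTrajectory (Nat.le_succ n) fun i _ h2 => hs i h2
  have hup0 : z n * depth u S z n ≤ E n := by
    have := (hs n (by omega)).upper
    rwa [hreach, add_sub_cancel_left] at this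
  have hE0 := C.E_le n hn0
  have hE1 := (C.E_le (n + 1) (by omega)).trans (K.κ_succ n hn0)
  have hwin := window_le C K hn0 fun i hi => hs i (by omega)
  have hw := K.w_lt n hn0
  have hκ := K.two_le_κ n hn0
  have hupper : reach S z (n + 1) < reach S z (n + 1 + 1) →
      (reach S z (n + 1 + 1) - reach S z (n + 1)) * depth u S z (n + 1) ≤ E (n + 1) := by
    intro hlt
    rw [← C.area (n + 1)]
    exact (C.unimodal (n + 1)).mul_le_area (z := z (n + 1)) (c := reach S z (n + 1))
      (d := reach S z (n + 1 + 1)) (k := depth u S z (n + 1)) (by linarith) hlt.le hreach2.le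
      fun x hx _ => by
        rw [hbey x hx, depth]
        have := C.unimodal_init.anti (Set.mem_Ici.2 hnn) (Set.mem_Ici.2 (hnn.trans hx.le)) hx.le
        linarith
  -- The radius is at most `2 * z n` plus the advance beyond the old reach; each part costs at most
  -- `2 * κ n`.
  have hz1le : z (n + 1) * depth u S z n ≤ 4 * κ n := by
    rcases lt_or_ge (reach S z (n + 1)) (reach S z (n + 1 + 1)) with hlt | hge
    · have h1 := hupper hlt
      have h2 : (reach S z (n + 1 + 1) - reach S z (n + 1)) * depth u S z n ≤ E (n + 1) :=
        (mul_le_mul_of_nonneg_left hdep (sub_nonneg.2 hlt.le)).trans h1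
      have h3 : z (n + 1) = 2 * z n + (reach S z (n + 1 + 1) - reach S z (n + 1)) := by linarith
      rw [h3]
      linarith
    · have h3 : z (n + 1) ≤ 2 * z n := by linarith
      have := mul_le_mul_of_nonneg_right h3 hR.le
      linarith
  have hA : leftGap S z v (n + 1) ≤ 2 * w n + 1 := by
    have hm : S (n - 2 * w n) ≤ S (n + 1) - z (n + 1) := by
      have h1 := (hs (n - 2 * w n) (by omega)).le_reach C.toTrajectory
      by_contra! hcon
      have h3 : reach S z n - reach S z (n - 2 * w n) < z n + z (n + 1) := by linarith
      have := mul_lt_mul_of_pos_right h3 hR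
      linarith
    have := C.leftGap_le (by omega) hm
    rw [Nat.cast_sub hw.le] at this
    push_cast at this ⊢
    linarith
  have harea := C.area_le (n + 1)
  -- Otherwise the right end stays in the interval at level `n`, so the right gap is at most `1` and
  -- the area at most `2 * z n * (2 * w n + 2)`. This is below the threshold `s n` that the area
  -- exceeds after a bad time.
  have hlt : reach S z (n + 1) < reach S z (n + 1 + 1) := by
    by_contra! hle
    have hz2 : z (n + 1) ≤ 2 * z n := by linarith
    have hB : rightGap S z v (n + 1) ≤ 1 := by
      have : S n + z n = reach S z (n + 1) := rfl
      have := C.le_inside (n := n) (y := S (n + 1) + z (n + 1)) ⟨by linarith, by linarith⟩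
      rw [rightGap]; push_cast; linarith
    have h1 := C.after_bad n hbad
    have h2 := K.s_ge n hn0
    have hdn := C.le_depth n
    have hw0 : (0 : ℝ) ≤ w n := Nat.cast_nonneg _
    have hnpos : (0 : ℝ) < n := by exact_mod_cast hn1
    have h3 : E (n + 1) ≤ 2 * z n * (2 * w n + 2) :=
      harea.trans (mul_le_mul hz2 (by linarith) (by
        have := C.leftGap_nonneg (n + 1); have := C.rightGap_nonneg (n + 1); linarith)
        (by linarith))
    have h4 : z n * n ≤ κ n := by
      have := mul_le_mul_of_nonneg_left hdn hz.le
      linarith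
    have h5 : E (n + 1) * n ≤ 2 * κ n * (2 * w n + 2) := by
      have e1 := mul_le_mul_of_nonneg_right h3 hnpos.le
      have e2 := mul_le_mul_of_nonneg_right h4 (show (0 : ℝ) ≤ 2 * (2 * w n + 2) by linarith)
      linarith
    have h6 := mul_lt_mul_of_pos_right h1 hnpos
    linarith
  have hB1 : ((n + 1 : ℕ) : ℝ) ≤ rightGap S z v (n + 1) := by
    have := C.unimodal_init.le_height (S (n + 1) + z (n + 1))
    rw [rightGap, hbey _ (by linarith)]
    linarith
  refine ⟨hnn, hbey, Or.inr ⟨n, rfl, hbad, hfr, hbk⟩, hlt, hupper hlt, fun _ hne => ?_,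
    fun _ hlt => by omega, fun _ => ?_⟩
  · linarith
  · refine C.fwd_tail _ (by omega) (fun hb => ?_) ?_
    · have := C.isolated n (n + 1) hbad hb (by omega)
      have := K.one_le_h n hn0
      omega
    · have h2 := K.w_θ (n + 1) (by omega)
      have hwm : (w n : ℝ) ≤ w (n + 1) := by exact_mod_cast K.w_mono (Nat.le_succ n)
      have hw0 : (0 : ℝ) ≤ w n := Nat.cast_nonneg _
      have h3 : 0 ≤ θ (n + 1) := by
        by_contra! hneg
        have : (0 : ℝ) ≤ ((n + 1 : ℕ) : ℝ) := Nat.cast_nonneg _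
        nlinarith
      have h4 := mul_le_mul_of_nonneg_left hB1 h3
      linarith

lemma stage (C : Controlled u E S z v bad κ θ s w h n₀) (K : Calibrated κ θ s w h η n₀) (n : ℕ) :
    Stage u E S z v bad η n₀ n := by
  induction n using Nat.strong_induction_on with
  | _ n ih =>
    rcases n with _ | n
    · exact stage_zero C
    have H := ih n (by omega)
    have hnn : 0 ≤ reach S z (n + 1) := H.nonneg.trans H.lt.le
    have hbey : ∀ y, reach S z (n + 1) < y → v (n + 1) y = u y := fun y hy => by
      rw [C.outside n y fun hm => absurd hm.2 (not_le.2 hy), H.beyond y (H.lt.trans hy)]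
    by_cases hfr : S (n + 1) = S n + z n
    · exact stage_front C K ih hnn hbey hfr
    · obtain ⟨hb, hf⟩ : bad n ∧ S n = reach S z n := by
        by_contra hcon
        exact hfr (H.fwd hcon)
      have hr : reach S z (n + 1) = S n + z n := rfl
      exact stage_back C K ih hnn hbey hb hf (by
        rw [hr, (C.step n).resolve_right hfr]; ring)

end Stage

/-! ### Blocks: displacement and confinement. -/

/-- The time at which block `j` begins. -/
noncomputable def blockTime (j : ℕ) : ℕ := ∑ i ∈ Finset.range j, blockLen i

lemma blockTime_zero : blockTime 0 = 0 := rfl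

lemma blockTime_succ (j : ℕ) : blockTime (j + 1) = blockTime j + blockLen j :=
  Finset.sum_range_succ _ _

lemma one_le_blockLen (j : ℕ) : 1 ≤ blockLen j := by
  have : (0 : ℝ) < 12 * (j : ℝ) ^ (1 / 4 : ℝ) + 1 := by positivity
  exact Nat.ceil_pos.2 this

lemma blockTime_strictMono : StrictMono blockTime :=
  strictMono_nat_of_lt_succ fun j => by
    have := one_le_blockLen j
    rw [blockTime_succ]; omega

lemma blockTime_pos {j : ℕ} (hj : 1 ≤ j) : 1 ≤ blockTime j := by
  have := blockTime_strictMono (show 0 < j by omega)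
  rw [blockTime_zero] at this; omega

lemma GoodBlock.reflect {ε : ℝ} {u : ℝ → ℝ} {S : ℕ → ℝ} {L : ℕ → ℕ} {j : ℕ}
    (h : GoodBlock ε (fun x => u (-x)) (fun n => -S n) L j) : GoodBlock ε u S L j := by
  have h1 : ∀ i, Zpos (fun n => -S n) L i = Zpos S L i := fun i => by
    simp [Zpos, Real.sign_neg]
  simp only [GoodBlock, Xdisp, h1, Njump, neg_neg, Real.sign_neg, mul_neg, neg_mul] at h ⊢
  exact h

lemma GoodBlock.mono {ε ε' : ℝ} (hε : ε ≤ ε') {u : ℝ → ℝ} {S : ℕ → ℝ} {L : ℕ → ℕ} {j : ℕ}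
    (hu : ∀ x, u x ≤ 0) (h : GoodBlock ε u S L j) : GoodBlock ε' u S L j := by
  have hN : ∀ i, 0 ≤ Njump u S L i := fun i => by
    have := hu (S (L i))
    have : (0 : ℝ) ≤ L i := Nat.cast_nonneg _
    rw [Njump]; linarith
  have hl : (1 : ℝ) ≤ blockLen j := by exact_mod_cast one_le_blockLen j
  refine ⟨h.1, ⟨le_trans ?_ h.2.1.1, h.2.1.2.trans ?_⟩, h.2.2⟩
  · exact mul_le_mul_of_nonneg_right (by linarith) (div_nonneg (by linarith) (hN _))
  · exact mul_le_mul_of_nonneg_right (by linarith) (div_nonneg (by linarith) (hN _))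

section Blocks

variable {u : ℝ → ℝ} {E S z : ℕ → ℝ} {v : ℕ → ℝ → ℝ} {bad : ℕ → Prop} {κ θ s : ℕ → ℝ}
  {w h : ℕ → ℕ} {ε : ℝ} {j₀ : ℕ}

lemma reach_strictMono (hs : ∀ n, Stage u E S z v bad ε j₀ n) : StrictMono (reach S z) :=
  strictMono_nat_of_lt_succ fun n => (hs n).lt

/-- Relations between the thresholds and the block lengths. -/
structure BlockCalibrated (κ : ℕ → ℝ) (w h : ℕ → ℕ) (ε : ℝ) (j₀ : ℕ) : Prop where
  κ_le : ∀ j n, j₀ ≤ j → n < blockTime (j + 1) → κ n ≤ ε / 3 * blockLen j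
  len_le : ∀ j b, j₀ ≤ j → blockTime j ≤ b → blockLen j ≤ h b
  w_le : ∀ j n, j₀ ≤ j → blockTime j ≤ n → n < blockTime (j + 1) →
    2 * w n ≤ blockLen (j - 1)

/-- Bounds on the sums over blocks of the areas, and absence of bad times at the end of blocks. -/
structure BlockRegular (E : ℕ → ℝ) (bad : ℕ → Prop) (ε : ℝ) (j₀ : ℕ) : Prop where
  last : ∀ j, j₀ ≤ j → ¬ bad (blockTime (j + 1) - 1)
  head : ∀ n, 1 ≤ n → n < blockTime j₀ → E n ≤ 1 + ε
  sum_ge : ∀ j, j₀ ≤ j →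
    (1 - ε / 3) * blockLen j ≤ ∑ i ∈ Finset.Ico (blockTime j) (blockTime (j + 1)), E i
  sum_le : ∀ j, j₀ ≤ j →
    ∑ i ∈ Finset.Ico (blockTime j) (blockTime (j + 1)), E i ≤ (1 + ε) * blockLen j

variable (C : Controlled u E S z v bad κ θ s w h (blockTime j₀))
  (K : Calibrated κ θ s w h (ε / 3) (blockTime j₀)) (B : BlockCalibrated κ w h ε j₀)
  (R : BlockRegular E bad ε j₀)

-- A walk off the right end has been bad one step earlier, and the last time of a block is never
-- bad. Hence $Z_j$ and $N_j$ are given by the reach and the depth.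
include C K R in
lemma pos_blockTime (j : ℕ) : S (blockTime j) = reach S z (blockTime j) := by
  rcases j with _ | j
  · exact C.start
  by_contra hne
  obtain ⟨m, hm, hb, -⟩ := (stage C K _).exists_bad hne
  have h1 := C.bad_ge m hb
  rcases lt_or_ge j j₀ with hlt | hge
  · have := blockTime_strictMono.monotone (show j + 1 ≤ j₀ by omega)
    omega
  · apply R.last j hge
    rwa [hm, Nat.add_sub_cancel]

-- Before block `j₀` every area is at least `1` and no term is lost. Later at most one term is lost,
-- since bad times in a block are further apart than its length, and it is at most `ε / 3 * blockLen
-- j`. The three errors `ε / 3` (lost term, block sum, factor `1 + η`) combine to `ε`.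
include C K B R in
lemma displacement_ge (hε : 0 ≤ ε) (hε1 : ε ≤ 1) {j : ℕ} (hj : 1 ≤ j) :
    (1 - ε) * ((blockLen j : ℝ) - 1) ≤ depth u S z (blockTime (j + 1)) *
      (reach S z (blockTime (j + 1)) - reach S z (blockTime j)) := by
  classical
  have hst := stage C K
  have hlt : blockTime j < blockTime (j + 1) := blockTime_strictMono (Nat.lt_succ_self j)
  have hpos := blockTime_pos hj
  have hl : (1 : ℝ) ≤ blockLen j := by exact_mod_cast one_le_blockLen j
  have hb1 := blockTime_succ j
  rcases lt_or_ge j j₀ with hjl | hge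
  · have hle := blockTime_strictMono.monotone (show j + 1 ≤ j₀ by omega)
    have h1 := sum_lower (bad := bad) (η := ε / 3) (n₀ := blockTime j₀) C.toTrajectory (c := 1)
      zero_le_one hlt.le (fun i _ _ => hst i) (fun i h1 h2 _ => by
        rw [one_mul]; exact (hst i).lower_head (by omega) (by omega))
    have h2 : ∑ i ∈ Finset.Ico (blockTime j) (blockTime (j + 1)), (1 : ℝ)
        ≤ ∑ i ∈ Finset.Ico (blockTime j) (blockTime (j + 1)),
          (if S i = reach S z i then E i else 0) := by
      refine Finset.sum_le_sum fun i hi => ?_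
      rw [Finset.mem_Ico] at hi
      rw [if_pos]
      · exact (C.E_head i (by omega) (by omega)).1
      · by_contra hne
        obtain ⟨m, rfl, hb, -⟩ := (hst i).exists_bad hne
        have := C.bad_ge m hb
        omega
    have h3 : ∑ i ∈ Finset.Ico (blockTime j) (blockTime (j + 1)), (1 : ℝ) = blockLen j := by
      simp [hb1]
    rw [one_mul] at h1
    nlinarith
  · have h1 := sum_lower (bad := bad) (η := ε / 3) (n₀ := blockTime j₀) C.toTrajectory
      (c := 1 + ε / 3) (by linarith) hlt.le (fun i _ _ => hst i) (fun i h1 h2 h3 =>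
        (hst i).lower (by omega) h3)
    have h2 := sum_sub_le (E := E) (S := S) (z := z) (a := blockTime j) (b := blockTime (j + 1))
      (c := ε / 3 * blockLen j) (by positivity)
      (fun i hi h1 h2 => by
        obtain ⟨b, rfl, hb, -⟩ := (hst i).exists_bad hi
        exact (C.E_le _ ((C.bad_ge b hb).trans (Nat.le_succ b))).trans (B.κ_le j _ hge h2))
      (fun i i' hi hi' h1 h2 h3 => by
        obtain ⟨b, rfl, hb, -⟩ := (hst i).exists_bad hi
        obtain ⟨b', rfl, hb', -⟩ := (hst i').exists_bad hi'
        have e1 := C.isolated b b' hb hb' (by omega)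
        have hbj : blockTime j ≤ b := by
          by_contra! hcon
          have : b + 1 = blockTime j := by omega
          rw [this] at hi
          exact hi (pos_blockTime C K R j)
        have e2 := B.len_le j b hge hbj
        omega)
    have h3 := R.sum_ge j hge
    have h5 : 0 ≤ depth u S z (blockTime (j + 1)) *
        (reach S z (blockTime (j + 1)) - reach S z (blockTime j)) :=
      mul_nonneg ((Nat.cast_nonneg _).trans (C.le_depth _))
        (sub_nonneg.2 ((reach_strictMono hst).monotone hlt.le))
    set X := depth u S z (blockTime (j + 1)) *
        (reach S z (blockTime (j + 1)) - reach S z (blockTime j))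
    have h6 : (1 - 2 * (ε / 3)) * blockLen j ≤ (1 + ε / 3) * X := by linarith
    have h7 : (1 + ε / 3) * ((1 - ε) * ((blockLen j : ℝ) - 1))
        ≤ (1 - 2 * (ε / 3)) * blockLen j := by
      nlinarith [mul_nonneg hε (sub_nonneg.2 hl), mul_nonneg (mul_nonneg hε hε) (sub_nonneg.2 hl)]
    exact le_of_mul_le_mul_left (h7.trans h6) (by linarith)

include C K R in
lemma displacement_le {j : ℕ} (hj : 1 ≤ j) :
    (reach S z (blockTime (j + 1)) - reach S z (blockTime j)) * depth u S z (blockTime j)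
      ≤ (1 + ε) * blockLen j := by
  have hlt : blockTime j < blockTime (j + 1) := blockTime_strictMono (Nat.lt_succ_self j)
  have hpos := blockTime_pos hj
  refine (sum_upper C.toTrajectory hlt.le fun i _ _ => stage C K i).trans ?_
  rcases lt_or_ge j j₀ with hjl | hge
  · have hle := blockTime_strictMono.monotone (show j + 1 ≤ j₀ by omega)
    refine (Finset.sum_le_card_nsmul _ _ (1 + ε) fun i hi => ?_).trans ?_
    · rw [Finset.mem_Ico] at hi
      exact R.head i (by omega) (by omega)
    · rw [Nat.card_Ico, blockTime_succ, Nat.add_sub_cancel_left, nsmul_eq_mul, mul_comm]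
  · exact R.sum_le j hge

-- Only a step to the left at a bad time `m` matters. It ends at `reach m - z m`, and by `window_le`
-- this lies to the right of the reach `2 * w m` steps earlier, a time that is not before block `j -
-- 1`.
include C K B R in
lemma lt_pos_of_block {j n : ℕ} (hj : 1 ≤ j) (h1 : blockTime j ≤ n)
    (h2 : n < blockTime (j + 1)) : reach S z (blockTime (j - 1)) < S n := by
  have hst := stage C K
  have hmono := reach_strictMono hst
  have hlt := blockTime_strictMono (show j - 1 < j by omega)
  by_cases hne : S n = reach S z n
  · rw [hne]; exact hmono (by omega)
  obtain ⟨m, rfl, hb, hf, hS⟩ := (hst n).exists_bad hne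
  have hmj : blockTime j ≤ m := by
    by_contra! hcon
    have : m + 1 = blockTime j := by omega
    rw [this] at hne
    exact hne (pos_blockTime C K R j)
  have hm0 := C.bad_ge m hb
  have hj0 : j₀ ≤ j := by
    by_contra! hcon
    have := blockTime_strictMono.monotone (show j + 1 ≤ j₀ by omega)
    omega
  have hwin := window_le C K hm0 fun i _ => hst i
  have hw := B.w_le j m hj0 hmj (by omega)
  have hbt : blockTime j = blockTime (j - 1) + blockLen (j - 1) := by
    rw [← blockTime_succ, Nat.sub_add_cancel hj]
  have hr : reach S z (m + 1) = reach S z m + z m := by rw [← hf]; rfl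
  have hup := (hst m).upper
  rw [hr, add_sub_cancel_left] at hup
  have hE := C.E_le m hm0
  have hκ := K.two_le_κ m hm0
  have hR : 0 < depth u S z m :=
    lt_of_lt_of_le (by exact_mod_cast (K.one_le.trans hm0)) (C.le_depth m)
  have hle : reach S z (blockTime (j - 1)) ≤ reach S z (m - 2 * w m) := hmono.monotone (by omega)
  by_contra! hcon
  have h3 : reach S z m - reach S z (m - 2 * w m) ≤ z m := by linarith
  have := mul_le_mul_of_nonneg_right h3 hR.le
  linarith

include C K B R in
theorem goodBlock (hε : 0 ≤ ε) (hε1 : ε ≤ 1) {j : ℕ} (hj : 1 ≤ j) :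
    GoodBlock ε u S blockTime j := by
  have hst := stage C K
  have hmono := reach_strictMono hst
  have hsign : Real.sign (S 1) = 1 := Real.sign_of_pos (by
    rw [C.first, C.start]; linarith [C.radius_pos 0])
  have hZ : ∀ i, Zpos S blockTime i = reach S z (blockTime i) := fun i => by
    rw [Zpos, hsign, one_mul, pos_blockTime C K R]
  have hN : ∀ i, Njump u S blockTime i = depth u S z (blockTime i) := fun i => by
    rw [Njump, depth, pos_blockTime C K R]
  have hpos : ∀ i, 1 ≤ i → 0 < depth u S z (blockTime i) := fun i hi =>
    lt_of_lt_of_le (by exact_mod_cast blockTime_pos hi) (C.le_depth _)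
  refine ⟨Or.inl ?_, ⟨?_, ?_⟩, fun n h1 h2 => ⟨?_, ?_⟩⟩
  · rw [Qlen, blockTime_succ]; push_cast; ring
  · rw [Xdisp, hZ, hZ, hN, ← mul_div_assoc, div_le_iff₀ (hpos _ (by omega))]
    have := displacement_ge C K B R hε hε1 hj
    linarith
  · rw [Xdisp, hZ, hZ, hN, ← mul_div_assoc, le_div_iff₀ (hpos _ hj)]
    exact displacement_le C K R hj
  · rw [hsign, one_mul, hZ]
    exact lt_pos_of_block C K B R hj h1 h2
  · rw [hsign, one_mul, hZ]
    exact ((hst n).le_reach C.toTrajectory).trans_lt (hmono h2)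

end Blocks

/-! ### The potentials of the greedy walk form a trajectory. -/

lemma UnimodalAt.nextPoint_eq {v : ℝ → ℝ} {s h : ℝ} (H : UnimodalAt v s h) (w : ℝ × ℝ) :
    nextPoint w v = if w.2 ≤ (h - v (s - radius w.1 v)) /
        ((h - v (s - radius w.1 v)) + (h - v (s + radius w.1 v)))
      then s - radius w.1 v else s + radius w.1 v := by
  simp only [nextPoint, H.peak_eq, H.height_eq]

lemma UnimodalAt.nextPoint_cases {v : ℝ → ℝ} {s h : ℝ} (H : UnimodalAt v s h) (w : ℝ × ℝ) :
    nextPoint w v = s - radius w.1 v ∨ nextPoint w v = s + radius w.1 v := by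
  rw [H.nextPoint_eq]
  split_ifs
  · exact Or.inl rfl
  · exact Or.inr rfl

lemma UnimodalAt.stepOp {v : ℝ → ℝ} {s h : ℝ} (H : UnimodalAt v s h) {w : ℝ × ℝ}
    (hw : 0 < w.1) : UnimodalAt (stepOp w v) (nextPoint w v) (h + 1) := by
  refine H.raise (H.radius_spec hw).1.le (H.nextPoint_cases w) ?_ (fun y hy hne => ?_)
    (fun y hy => ?_)
  · simp [GreedyWalk.stepOp, H.height_eq]
  · simp only [GreedyWalk.stepOp, if_neg hne, H.peak_eq, if_pos hy, H.height_eq]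
  · have hne : y ≠ nextPoint w v := by
      rintro rfl
      have := (H.radius_spec hw).1
      exact hy (by rcases H.nextPoint_cases w with h | h <;> rw [h] <;> constructor <;> linarith)
    simp only [GreedyWalk.stepOp, if_neg hne, H.peak_eq, if_neg hy]

section Walk

variable {u : ℝ → ℝ} {w : ℕ → ℝ × ℝ}

lemma unimodalAt_potentialSeq (H : UnimodalAt u 0 0) (hw : ∀ n, 0 < (w n).1) (n : ℕ) :
    UnimodalAt (potentialSeq u w n) (peak (potentialSeq u w n)) n := by
  induction n with
  | zero =>
    simp only [potentialSeq, H.peak_eq, Nat.cast_zero]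
    exact H
  | succ n ih =>
    have := ih.stepOp (hw n)
    simp only [potentialSeq]
    rw [this.peak_eq]
    push_cast
    exact this

lemma peak_potentialSeq_succ (H : UnimodalAt u 0 0) (hw : ∀ n, 0 < (w n).1) (n : ℕ) :
    peak (potentialSeq u w (n + 1)) = nextPoint (w n) (potentialSeq u w n) :=
  ((unimodalAt_potentialSeq H hw n).stepOp (hw n)).peak_eq

lemma trajectory_potentialSeq (H : UnimodalAt u 0 0) (hw : ∀ n, 0 < (w n).1) :
    Trajectory u (fun n => (w n).1) (fun n => peak (potentialSeq u w n))
      (fun n => radius (w n).1 (potentialSeq u w n)) (potentialSeq u w) where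
  init := rfl
  start := H.peak_eq
  unimodal := unimodalAt_potentialSeq H hw
  radius_pos n := ((unimodalAt_potentialSeq H hw n).radius_spec (hw n)).1
  area n := ((unimodalAt_potentialSeq H hw n).radius_spec (hw n)).2
  step n := by
    rw [peak_potentialSeq_succ H hw]
    exact (unimodalAt_potentialSeq H hw n).nextPoint_cases _
  inside n y hy hne := by
    rw [peak_potentialSeq_succ H hw] at hne
    have h := (unimodalAt_potentialSeq H hw n).height_eq
    simp only [potentialSeq, stepOp, if_neg hne, if_pos hy, h]
  outside n y hy := by
    have H' := unimodalAt_potentialSeq H hw n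
    have hne : y ≠ nextPoint (w n) (potentialSeq u w n) := by
      rintro rfl
      have := (H'.radius_spec (hw n)).1
      exact hy (by
        rcases H'.nextPoint_cases (w n) with h | h <;> rw [h] <;> constructor <;> linarith)
    simp only [potentialSeq, stepOp, if_neg hne, if_neg hy]

lemma peak_succ_of_le (H : UnimodalAt u 0 0) (hw : ∀ n, 0 < (w n).1) {n : ℕ} {a b : ℝ}
    (ha : a = leftGap (fun n => peak (potentialSeq u w n))
      (fun n => radius (w n).1 (potentialSeq u w n)) (potentialSeq u w) n)
    (hb : b = rightGap (fun n => peak (potentialSeq u w n))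
      (fun n => radius (w n).1 (potentialSeq u w n)) (potentialSeq u w) n)
    (h : (w n).2 ≤ a / (a + b)) :
    peak (potentialSeq u w (n + 1))
      = peak (potentialSeq u w n) - radius (w n).1 (potentialSeq u w n) := by
  rw [peak_potentialSeq_succ H hw, (unimodalAt_potentialSeq H hw n).nextPoint_eq, if_pos]
  rw [ha, hb] at h
  exact h

lemma peak_succ_of_lt (H : UnimodalAt u 0 0) (hw : ∀ n, 0 < (w n).1) {n : ℕ} {a b : ℝ}
    (ha : a = leftGap (fun n => peak (potentialSeq u w n))
      (fun n => radius (w n).1 (potentialSeq u w n)) (potentialSeq u w) n)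
    (hb : b = rightGap (fun n => peak (potentialSeq u w n))
      (fun n => radius (w n).1 (potentialSeq u w n)) (potentialSeq u w) n)
    (h : a / (a + b) < (w n).2) :
    peak (potentialSeq u w (n + 1))
      = peak (potentialSeq u w n) + radius (w n).1 (potentialSeq u w n) := by
  rw [peak_potentialSeq_succ H hw, (unimodalAt_potentialSeq H hw n).nextPoint_eq, if_neg]
  rw [ha, hb] at h
  exact not_le.2 h

end Walk

/-! ### Typical driving variables give good blocks. -/

/-- The time `n` is bad if it is not before `n₀` and the uniform variable `U n` is close to an
end of the unit interval. -/
def IsBad (θ U : ℕ → ℝ) (n₀ n : ℕ) : Prop := n₀ ≤ n ∧ ¬ (θ n < U n ∧ U n < 1 - θ n)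

/-- The typical behaviour of the driving variables from time `blockTime j₀` on. -/
structure TypicalTail (E U : ℕ → ℝ) (κ θ s : ℕ → ℝ) (w h : ℕ → ℕ) (ε : ℝ) (j₀ : ℕ) : Prop where
  pos : ∀ n, blockTime j₀ ≤ n → 0 < E n
  E_le : ∀ n, blockTime j₀ ≤ n → E n ≤ κ n
  window : ∀ n, blockTime j₀ ≤ n - w n → 11 * κ n ≤ ∑ i ∈ Finset.Ico (n - w n) n, E i
  isolated : ∀ b, blockTime j₀ ≤ b → ∀ b' ∈ Finset.Ioc b (b + h b),
    ¬ (IsBad θ U (blockTime j₀) b ∧ IsBad θ U (blockTime j₀) b')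
  after_bad : ∀ b, blockTime j₀ ≤ b → ¬ (IsBad θ U (blockTime j₀) b ∧ E (b + 1) ≤ s b)
  last : ∀ j, j₀ ≤ j → ¬ IsBad θ U (blockTime j₀) (blockTime (j + 1) - 1)
  sum_ge : ∀ j, j₀ ≤ j →
    (1 - ε / 3) * blockLen j ≤ ∑ i ∈ Finset.Ico (blockTime j) (blockTime (j + 1)), E i
  sum_le : ∀ j, j₀ ≤ j →
    ∑ i ∈ Finset.Ico (blockTime j) (blockTime (j + 1)), E i ≤ (1 + ε) * blockLen j

/-- The areas that the driving variables prescribe before the time `n₀`. -/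
structure TypicalHead (E : ℕ → ℝ) (ε : ℝ) (n₀ : ℕ) : Prop where
  zero : E 0 ∈ Set.Icc 2 3
  pos : ∀ n, 1 ≤ n → n < n₀ → E n ∈ Set.Icc 1 (1 + ε)

section Deterministic

variable {u : ℝ → ℝ} {E U S z : ℕ → ℝ} {v : ℕ → ℝ → ℝ} {κ θ s : ℕ → ℝ}
  {w h : ℕ → ℕ} {ε : ℝ} {j₀ : ℕ}

lemma controlled_of_typical (T : Trajectory u E S z v)
    (K : Calibrated κ θ s w h (ε / 3) (blockTime j₀))
    (hκw : ∀ n, blockTime j₀ ≤ n → 11 * κ n ≤ w n) (hε : ε ≤ 1)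
    (hT : TypicalTail E U κ θ s w h ε j₀) (hH : TypicalHead E ε (blockTime j₀))
    (hgap : leftGap S z v 0 ≤ rightGap S z v 0)
    (hfh : ∀ n, n < blockTime j₀ → leftGap S z v n ≤ rightGap S z v n → S (n + 1) = S n + z n)
    (hft : ∀ n, θ n < U n → U n < 1 - θ n → leftGap S z v n ≤ θ n * rightGap S z v n →
      S (n + 1) = S n + z n) :
    Controlled u E S z v (IsBad θ U (blockTime j₀)) κ θ s w h (blockTime j₀) where
  toTrajectory := T
  first := hfh 0 K.one_le hgap
  first_gap := hgap
  two_le_E := hH.zero.1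
  E_head n h1 h2 := ⟨(hH.pos n h1 h2).1, (hH.pos n h1 h2).2.trans (by linarith)⟩
  fwd_head n _ h2 h3 := hfh n h2 h3
  bad_ge n hb := hb.1
  fwd_tail n hn hb h3 := by
    have : θ n < U n ∧ U n < 1 - θ n := by
      by_contra hcon
      exact hb ⟨hn, hcon⟩
    exact hft n this.1 this.2 h3
  E_le := hT.E_le
  window n hn := by
    have hw := K.w_lt n hn
    -- Tail conditions may involve tail variables only, hence the window of length `2 * w n`. Either
    -- its second half lies in the tail, or its first half lies in the head, where each area is at
    -- least `1`.
    rcases le_or_gt (blockTime j₀) (n - w n) with hle | hlt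
    · refine (hT.window n hle).trans (Finset.sum_le_sum_of_subset_of_nonneg
        (Finset.Ico_subset_Ico_left (by omega)) fun i _ _ => (T.E_pos i).le)
    · have h1 : ∑ i ∈ Finset.Ico (n - 2 * w n) (n - w n), (1 : ℝ)
          ≤ ∑ i ∈ Finset.Ico (n - 2 * w n) n, E i := by
        refine (Finset.sum_le_sum fun i hi => ?_).trans (Finset.sum_le_sum_of_subset_of_nonneg
          (Finset.Ico_subset_Ico_right (by omega)) fun i _ _ => (T.E_pos i).le)
        rw [Finset.mem_Ico] at hi
        exact (hH.pos i (by omega) (by omega)).1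
      have h2 : ∑ i ∈ Finset.Ico (n - 2 * w n) (n - w n), (1 : ℝ) = w n := by
        rw [Finset.sum_const, Nat.card_Ico, nsmul_eq_mul, mul_one]
        congr 1; omega
      have := hκw n hn
      linarith
  isolated b b' hb hb' hlt := by
    by_contra! hcon
    exact hT.isolated b hb.1 b' (Finset.mem_Ioc.2 ⟨hlt, hcon⟩) ⟨hb, hb'⟩
  after_bad b hb := by
    by_contra! hcon
    exact hT.after_bad b hb.1 ⟨hb, hcon⟩

lemma goodBlock_of_typical (T : Trajectory u E S z v)
    (K : Calibrated κ θ s w h (ε / 3) (blockTime j₀)) (B : BlockCalibrated κ w h ε j₀)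
    (hκw : ∀ n, blockTime j₀ ≤ n → 11 * κ n ≤ w n) (hε0 : 0 ≤ ε) (hε : ε ≤ 1)
    (hT : TypicalTail E U κ θ s w h ε j₀) (hH : TypicalHead E ε (blockTime j₀))
    (hgap : leftGap S z v 0 ≤ rightGap S z v 0)
    (hfh : ∀ n, n < blockTime j₀ → leftGap S z v n ≤ rightGap S z v n → S (n + 1) = S n + z n)
    (hft : ∀ n, θ n < U n → U n < 1 - θ n → leftGap S z v n ≤ θ n * rightGap S z v n →
      S (n + 1) = S n + z n) {j : ℕ} (hj : 1 ≤ j) : GoodBlock ε u S blockTime j :=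
  goodBlock (controlled_of_typical T K hκw hε hT hH hgap hfh hft) K B
    ⟨hT.last, fun n h1 h2 => (hH.pos n h1 h2).2, hT.sum_ge, hT.sum_le⟩ hε0 hε hj

/-- The side of the larger gap at time `0` is determined by `E 0`. The head values of `U` are then
required to lie on the matching side of `1 / 2`, and the left case is reduced to the right one by
reflection. -/
theorem goodBlock_potentialSeq (H : UnimodalAt u 0 0)
    (K : Calibrated κ θ s w h (ε / 3) (blockTime j₀)) (B : BlockCalibrated κ w h ε j₀)
    (hκw : ∀ n, blockTime j₀ ≤ n → 11 * κ n ≤ w n) (hε0 : 0 ≤ ε) (hε : ε ≤ 1)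
    (hT : TypicalTail E U κ θ s w h ε j₀) (hH : TypicalHead E ε (blockTime j₀))
    (hU : (u (radius (E 0) u) ≤ u (-radius (E 0) u) ∧ ∀ n < blockTime j₀, 1 / 2 < U n) ∨
      (u (-radius (E 0) u) ≤ u (radius (E 0) u) ∧ ∀ n < blockTime j₀, U n < 1 / 2))
    {j : ℕ} (hj : 1 ≤ j) :
    GoodBlock ε u (fun n => peak (potentialSeq u (fun k => (E k, U k)) n)) blockTime j := by
  have hE : ∀ n, 0 < E n := fun n => by
    rcases lt_or_ge n (blockTime j₀) with hlt | hge
    · rcases Nat.eq_zero_or_pos n with rfl | hpos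
      · linarith [hH.zero.1]
      · linarith [(hH.pos n hpos hlt).1]
    · exact hT.pos n hge
  have T := trajectory_potentialSeq (w := fun k => (E k, U k)) H hE
  have hleft := fun n => T.leftGap_pos n
  have hright := fun n => T.rightGap_pos n
  have hp0 : peak u = 0 := H.peak_eq
  rcases hU with ⟨h0, hU⟩ | ⟨h0, hU⟩
  · refine goodBlock_of_typical T K B hκw hε0 hε hT hH ?_ (fun n hn hg => ?_)
      (fun n h1 h2 hg => ?_) hj
    · simp only [leftGap, rightGap, potentialSeq, hp0, zero_sub, zero_add]
      linarith
    · refine peak_succ_of_lt H hE rfl rfl (lt_of_le_of_lt ?_ (hU n hn))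
      rw [div_le_iff₀ (add_pos (hleft n) (hright n))]
      linarith
    · refine peak_succ_of_lt H hE rfl rfl (lt_of_le_of_lt ?_ h1)
      rw [div_le_iff₀ (add_pos (hleft n) (hright n))]
      have hθ : 0 ≤ θ n := by
        by_contra! hneg
        have := mul_neg_of_neg_of_pos hneg (hright n)
        linarith [hleft n]
      have := mul_nonneg hθ (hleft n).le
      linarith
  · refine GoodBlock.reflect (goodBlock_of_typical T.reflect K B hκw hε0 hε hT hH ?_
      (fun n hn hg => ?_) (fun n h1 h2 hg => ?_) hj)
    · simp only [leftGap, rightGap, potentialSeq, hp0, neg_zero, zero_sub, zero_add, neg_neg]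
      linarith
    · rw [Trajectory.leftGap_reflect, Trajectory.rightGap_reflect] at hg
      rw [peak_succ_of_le H hE rfl rfl]
      · ring
      · refine le_trans (hU n hn).le ?_
        rw [le_div_iff₀ (add_pos (hleft n) (hright n))]
        linarith
    · rw [Trajectory.leftGap_reflect, Trajectory.rightGap_reflect] at hg
      rw [peak_succ_of_le H hE rfl rfl]
      · ring
      · refine le_trans h2.le ?_
        rw [le_div_iff₀ (add_pos (hleft n) (hright n))]
        have hθ : 0 ≤ θ n := by
          by_contra! hneg
          have := mul_neg_of_neg_of_pos hneg (hleft n)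
          linarith [hright n]
        have := mul_nonneg hθ (hright n).le
        linarith

end Deterministic

/-! ### Laws, exponential moments and independence of the driving variables. -/

lemma expMeasure_one_Iic (x : ℝ) :
    expMeasure 1 (Set.Iic x) = ENNReal.ofReal (if 0 ≤ x then 1 - Real.exp (-x) else 0) := by
  have := isProbabilityMeasure_expMeasure one_pos
  have h := cdf_expMeasure_eq one_pos x
  rw [one_mul, cdf_eq_real] at h
  rw [← h, ofReal_measureReal]

/-- Tilting the density of rate `1` by `exp (t * x)` gives `1 / (1 - t)` times the density of rate
`1 - t`. -/
lemma lintegral_exp_mul_expMeasure {t : ℝ} (ht : t < 1) :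
    ∫⁻ x, ENNReal.ofReal (Real.exp (t * x)) ∂(expMeasure 1) = ENNReal.ofReal (1 / (1 - t)) := by
  have h1 : 0 < 1 - t := by linarith
  have hm : Measurable (gammaPDF 1 1) := (measurable_gammaPDFReal 1 1).ennreal_ofReal
  rw [expMeasure, gammaMeasure, lintegral_withDensity_eq_lintegral_mul _ hm (by fun_prop)]
  have : ∀ x, (gammaPDF 1 1 * fun x => ENNReal.ofReal (Real.exp (t * x))) x
      = ENNReal.ofReal (1 / (1 - t)) * exponentialPDF (1 - t) x := by
    intro x
    have hpdf : gammaPDF 1 1 x = exponentialPDF 1 x := rfl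
    rw [Pi.mul_apply, hpdf, exponentialPDF_eq, exponentialPDF_eq,
      ← ENNReal.ofReal_mul (by split_ifs <;> positivity), ← ENNReal.ofReal_mul (by positivity)]
    congr 1
    split_ifs
    · have : Real.exp (-((1 - t) * x)) = Real.exp (-(1 * x)) * Real.exp (t * x) := by
        rw [← Real.exp_add]; ring_nf
      rw [this]
      field_simp
    · ring
  simp_rw [this]
  rw [lintegral_const_mul' _ _ ENNReal.ofReal_ne_top, lintegral_exponentialPDF_eq_one h1, mul_one]

namespace IsDriving

variable {Ω : Type*} [MeasurableSpace Ω] {P : Measure Ω}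
  {E U : ℕ → Ω → ℝ} (D : IsDriving P E U)

include D

lemma measure_E_le (n : ℕ) (x : ℝ) :
    P {ω | E n ω ≤ x} = ENNReal.ofReal (if 0 ≤ x then 1 - Real.exp (-x) else 0) := by
  have : P {ω | E n ω ≤ x} = P.map (E n) (Set.Iic x) := by
    rw [Measure.map_apply (D.measurable_E n) measurableSet_Iic]; rfl
  rw [this, D.law_E, expMeasure_one_Iic]

lemma measure_E_le_le (n : ℕ) {x : ℝ} (hx : 0 ≤ x) : P {ω | E n ω ≤ x} ≤ ENNReal.ofReal x := by
  rw [D.measure_E_le, if_pos hx]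
  refine ENNReal.ofReal_le_ofReal ?_
  have := Real.add_one_le_exp (-x)
  linarith

lemma measure_E_nonpos (n : ℕ) : P {ω | E n ω ≤ 0} = 0 := by
  rw [D.measure_E_le]; simp

lemma measure_lt_E [IsProbabilityMeasure P] (n : ℕ) {x : ℝ} (hx : 0 ≤ x) :
    P {ω | x < E n ω} = ENNReal.ofReal (Real.exp (-x)) := by
  have h : {ω | x < E n ω} = {ω | E n ω ≤ x}ᶜ := by ext; simp
  rw [h, prob_compl_eq_one_sub
    (show MeasurableSet {ω | E n ω ≤ x} from D.measurable_E n measurableSet_Iic),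
    D.measure_E_le, if_pos hx,
    ← ENNReal.ofReal_one, ← ENNReal.ofReal_sub _ (by
      rw [sub_nonneg]; exact Real.exp_le_one_iff.2 (by linarith))]
  congr 1; ring

lemma measure_U_preimage (n : ℕ) {A : Set ℝ} (hA : MeasurableSet A) :
    P (U n ⁻¹' A) = volume (A ∩ Set.Ioo 0 1) := by
  rw [← Measure.map_apply (D.measurable_U n) hA, D.law_U, Measure.restrict_apply hA]

lemma measure_U_extreme (n : ℕ) {t : ℝ} (ht : 0 ≤ t) :
    P {ω | ¬ (t < U n ω ∧ U n ω < 1 - t)} ≤ ENNReal.ofReal (2 * t) := by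
  have h1 : P {ω | ¬ (t < U n ω ∧ U n ω < 1 - t)}
      = P (U n ⁻¹' {x | ¬ (t < x ∧ x < 1 - t)}) := rfl
  have hA : MeasurableSet {x : ℝ | ¬ (t < x ∧ x < 1 - t)} :=
    (measurableSet_Ioo (a := t) (b := 1 - t)).compl
  rw [h1, D.measure_U_preimage n hA]
  refine (measure_mono (t := Set.Icc 0 t ∪ Set.Icc (1 - t) 1) ?_).trans
    ((measure_union_le _ _).trans ?_)
  · rintro x ⟨hx, h0, h1⟩
    by_cases h : t < x
    · right
      refine ⟨?_, h1.le⟩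
      by_contra! hcon
      exact hx ⟨h, hcon⟩
    · left
      exact ⟨h0.le, not_lt.1 h⟩
  · rw [Real.volume_Icc, Real.volume_Icc, ← ENNReal.ofReal_add (by linarith) (by linarith)]
    exact ENNReal.ofReal_le_ofReal (by linarith)

lemma indep_E : iIndepFun E P :=
  D.indep.precomp (g := Sum.inl) Sum.inl_injective

lemma integrable_exp (n : ℕ) {t : ℝ} (ht : t < 1) :
    Integrable (fun ω => Real.exp (t * E n ω)) P ∧ mgf (E n) P t = 1 / (1 - t) := by
  have hm := D.measurable_E n
  have h1 : 0 < 1 - t := by linarith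
  have hl : ∫⁻ ω, ENNReal.ofReal (Real.exp (t * E n ω)) ∂P = ENNReal.ofReal (1 / (1 - t)) := by
    rw [← lintegral_exp_mul_expMeasure ht, ← D.law_E n, lintegral_map (by fun_prop) hm]
  have hms : AEStronglyMeasurable (fun ω => Real.exp (t * E n ω)) P :=
    (by fun_prop : Measurable fun ω => Real.exp (t * E n ω)).aestronglyMeasurable
  have hnn : 0 ≤ᵐ[P] fun ω => Real.exp (t * E n ω) := ae_of_all _ fun ω => (Real.exp_pos _).le
  refine ⟨⟨hms, ?_⟩, ?_⟩
  · rw [hasFiniteIntegral_iff_ofReal hnn, hl]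
    exact ENNReal.ofReal_lt_top
  · rw [mgf, integral_eq_lintegral_of_nonneg_ae hnn hms, hl, ENNReal.toReal_ofReal (by positivity)]

lemma measure_sum_le [IsProbabilityMeasure P] (A : Finset ℕ) (x : ℝ) {t : ℝ} (ht : 0 ≤ t) :
    P {ω | ∑ i ∈ A, E i ω ≤ x}
      ≤ ENNReal.ofReal (Real.exp (t * x) * (1 / (1 + t)) ^ A.card) := by
  have hint := D.indep_E.integrable_exp_mul_sum D.measurable_E (s := A) (t := -t)
    fun i _ => (D.integrable_exp i (by linarith)).1
  have h := measure_le_le_exp_mul_mgf x (neg_nonpos.2 ht) hint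
  rw [D.indep_E.mgf_sum D.measurable_E,
    Finset.prod_congr rfl fun i _ => (D.integrable_exp i (show -t < 1 by linarith)).2,
    Finset.prod_const, neg_neg, sub_neg_eq_add] at h
  simp only [Finset.sum_apply] at h
  rw [← ofReal_measureReal]
  exact ENNReal.ofReal_le_ofReal h

lemma measure_le_sum [IsProbabilityMeasure P] (A : Finset ℕ) (x : ℝ) {t : ℝ}
    (ht : 0 ≤ t) (ht1 : t < 1) :
    P {ω | x ≤ ∑ i ∈ A, E i ω}
      ≤ ENNReal.ofReal (Real.exp (-t * x) * (1 / (1 - t)) ^ A.card) := by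
  have hint := D.indep_E.integrable_exp_mul_sum D.measurable_E (s := A) (t := t)
    fun i _ => (D.integrable_exp i ht1).1
  have h := measure_ge_le_exp_mul_mgf x ht hint
  rw [D.indep_E.mgf_sum D.measurable_E,
    Finset.prod_congr rfl fun i _ => (D.integrable_exp i ht1).2,
    Finset.prod_const] at h
  simp only [Finset.sum_apply] at h
  rw [← ofReal_measureReal]
  exact ENNReal.ofReal_le_ofReal h

lemma measure_inter_UU {n m : ℕ} (hnm : n ≠ m) {A B : Set ℝ} (hA : MeasurableSet A)
    (hB : MeasurableSet B) : P (U n ⁻¹' A ∩ U m ⁻¹' B) = P (U n ⁻¹' A) * P (U m ⁻¹' B) :=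
  (D.indep.indepFun (i := Sum.inr n) (j := Sum.inr m)
    (by simpa using hnm)).measure_inter_preimage_eq_mul A B hA hB

lemma measure_inter_UE (n m : ℕ) {A B : Set ℝ} (hA : MeasurableSet A)
    (hB : MeasurableSet B) : P (U n ⁻¹' A ∩ E m ⁻¹' B) = P (U n ⁻¹' A) * P (E m ⁻¹' B) :=
  (D.indep.indepFun (i := Sum.inr n) (j := Sum.inl m)
    (by simp)).measure_inter_preimage_eq_mul A B hA hB

end IsDriving

/-! ### The thresholds and their growth. -/

noncomputable section

/-- The slowly growing sequence `n ^ (1/10)`, in terms of which the thresholds are defined. -/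
def slow (n : ℕ) : ℝ := (n : ℝ) ^ (1 / 10 : ℝ)

/-- An upper threshold for the area at step `n`. -/
def capE (n : ℕ) : ℝ := slow n / 200

/-- Half the number of past steps that is relevant for the left gap at time `n`. -/
def windowLen (n : ℕ) : ℕ := ⌈slow n⌉₊

/-- The distance of `U n` from the ends of the unit interval at which the time `n` is bad. -/
def badProb (n : ℕ) : ℝ := 6 * slow n / n

/-- A lower threshold for the area after a step at a bad time. -/
def smallE (n : ℕ) : ℝ := slow n ^ 2 / n

/-- A bound from below for the distance between bad times. -/
def gapLen (n : ℕ) : ℕ := ⌊(n : ℝ) ^ (1 / 4 : ℝ)⌋₊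

end

lemma eventually_mul_rpow_le (C : ℝ) {p q : ℝ} (hpq : p < q) :
    ∀ᶠ n : ℕ in atTop, C * (n : ℝ) ^ p ≤ (n : ℝ) ^ q := by
  have h := ((tendsto_rpow_atTop (sub_pos.2 hpq)).comp
    tendsto_natCast_atTop_atTop).eventually_ge_atTop C
  filter_upwards [h, eventually_ge_atTop 1] with n hn hn1
  have hn0 : (0 : ℝ) < n := by exact_mod_cast hn1
  rw [← sub_add_cancel q p, Real.rpow_add hn0]
  exact mul_le_mul_of_nonneg_right hn (by positivity)

lemma slow_nonneg (n : ℕ) : 0 ≤ slow n := by unfold slow; positivity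

lemma slow_mono : Monotone slow := fun _ _ h =>
  Real.rpow_le_rpow (Nat.cast_nonneg _) (by exact_mod_cast h) (by norm_num)

lemma windowLen_le (n : ℕ) : (windowLen n : ℝ) ≤ slow n + 1 :=
  (Nat.ceil_lt_add_one (slow_nonneg n)).le

lemma le_windowLen (n : ℕ) : slow n ≤ windowLen n := Nat.le_ceil _

lemma capE_le (n : ℕ) : 11 * capE n ≤ windowLen n := by
  have := le_windowLen n
  have := slow_nonneg n
  rw [capE]; linarith

lemma slow_le_two_mul {a b : ℕ} (h : a ≤ 2 * b) : slow a ≤ 2 * slow b := by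
  have h1 : slow a ≤ ((2 : ℝ) * b) ^ (1 / 10 : ℝ) :=
    Real.rpow_le_rpow (Nat.cast_nonneg _) (by exact_mod_cast h) (by norm_num)
  have h2 : (2 : ℝ) ^ (1 / 10 : ℝ) ≤ 2 := by
    conv_rhs => rw [← Real.rpow_one 2]
    exact Real.rpow_le_rpow_of_exponent_le (by norm_num) (by norm_num)
  rw [Real.mul_rpow (by norm_num) (Nat.cast_nonneg _)] at h1
  have := slow_nonneg b
  exact h1.trans (mul_le_mul_of_nonneg_right h2 this)

/-- Caps and windows are of order $n^{1/10}$, negligible against both $n$ and the isolation distance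
$n^{1/4}$. -/
lemma calibrated_eventually {η : ℝ} (hη : 0 < η) (hη1 : η ≤ 1) :
    ∀ᶠ n₀ in atTop, Calibrated capE badProb smallE windowLen gapLen η n₀ := by
  have e1 := eventually_mul_rpow_le 400 (show (0 : ℝ) < 1 / 10 by norm_num)
  have e2 := eventually_mul_rpow_le 8 (show (1 / 10 : ℝ) < 1 by norm_num)
  have e3 := eventually_mul_rpow_le (4 / η) (show (1 / 10 : ℝ) < 1 by norm_num)
  have e4 := eventually_mul_rpow_le 10 (show (1 / 10 : ℝ) < 1 / 4 by norm_num)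
  obtain ⟨N, hN⟩ := eventually_atTop.1 (e1.and (e2.and (e3.and e4)))
  filter_upwards [eventually_ge_atTop N, eventually_ge_atTop 1] with n₀ hn₀ hone
  have hb : ∀ n, n₀ ≤ n → 400 ≤ slow n ∧ 8 * slow n ≤ n ∧ 4 * slow n ≤ η * n ∧
      10 * slow n ≤ (n : ℝ) ^ (1 / 4 : ℝ) ∧ (1 : ℝ) ≤ n := fun n hn => by
    obtain ⟨h1, h2, h3, h4⟩ := hN n (hn₀.trans hn)
    rw [Real.rpow_zero, mul_one] at h1
    rw [Real.rpow_one] at h2 h3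
    refine ⟨h1, h2, ?_, h4, by exact_mod_cast hone.trans hn⟩
    rw [div_mul_eq_mul_div, div_le_iff₀ hη] at h3
    rw [mul_comm η]; exact h3
  refine ⟨hone, hη.le, hη1, fun a b hab => ?_, fun a b hab => ?_, fun n hn => ?_, fun n hn => ?_,
    fun n hn => ?_, fun n hn => ?_, fun n hn => ?_, fun n hn => ?_, fun b n hb0 hbn hnb => ?_,
    fun b hb0 => ?_⟩
  · exact div_le_div_of_nonneg_right (slow_mono hab) (by norm_num)
  · exact Nat.ceil_mono (slow_mono hab)
  · rw [capE]; linarith [(hb n hn).1]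
  · have := slow_le_two_mul (show n + 1 ≤ 2 * n by omega)
    rw [capE, capE]; linarith
  · have h1 := windowLen_le n
    obtain ⟨h2, h3, -⟩ := hb n hn
    have : (2 * windowLen n : ℝ) < n := by linarith
    exact_mod_cast this
  · have h1 := windowLen_le n
    obtain ⟨h2, -, -, -, h3⟩ := hb n hn
    rw [badProb, div_mul_cancel₀ _ (by linarith)]
    linarith
  · have h1 := windowLen_le n
    obtain ⟨h2, -, h3, -⟩ := hb n hn
    linarith
  · have h1 := windowLen_le n
    obtain ⟨h2, -, -, -, h3⟩ := hb n hn
    rw [smallE, div_mul_cancel₀ _ (by linarith), capE]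
    nlinarith
  · have h1 := windowLen_le n
    obtain ⟨h2, h3, -⟩ := hb n (by omega)
    have hnb' : (n : ℝ) ≤ b + 2 * windowLen n + 1 := by exact_mod_cast hnb
    have h4 : n ≤ 2 * b := by
      have : (n : ℝ) ≤ 2 * b := by linarith
      exact_mod_cast this
    have h5 := slow_le_two_mul h4
    obtain ⟨h6, -, -, h7, -⟩ := hb b hb0
    refine Nat.le_floor ?_
    push_cast
    linarith
  · obtain ⟨h6, -, -, h7, -⟩ := hb b hb0
    refine Nat.le_floor ?_
    push_cast
    linarith

lemma le_blockLen (j : ℕ) : 12 * (j : ℝ) ^ (1 / 4 : ℝ) + 1 ≤ blockLen j := Nat.le_ceil _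

lemma blockLen_le {j : ℕ} (hj : 1 ≤ j) : (blockLen j : ℝ) ≤ 14 * (j : ℝ) ^ (1 / 4 : ℝ) := by
  have h1 : (blockLen j : ℝ) < 12 * (j : ℝ) ^ (1 / 4 : ℝ) + 1 + 1 :=
    Nat.ceil_lt_add_one (by positivity)
  have h2 : (1 : ℝ) ≤ (j : ℝ) ^ (1 / 4 : ℝ) :=
    Real.one_le_rpow (by exact_mod_cast hj) (by norm_num)
  linarith

lemma blockLen_mono : Monotone blockLen := fun a b hab => Nat.ceil_mono (by
  have : (a : ℝ) ^ (1 / 4 : ℝ) ≤ (b : ℝ) ^ (1 / 4 : ℝ) :=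
    Real.rpow_le_rpow (Nat.cast_nonneg _) (by exact_mod_cast hab) (by norm_num)
  linarith)

lemma rpow_five_fourths {x : ℝ} (hx : 0 < x) : x ^ (5 / 4 : ℝ) = x * x ^ (1 / 4 : ℝ) := by
  rw [← Real.rpow_one_add' hx.le (by norm_num)]; norm_num

/-- Induction: the increment of $j^{5/4}$ is at most $3j^{1/4}$ for $j\ge1$, below the block length.
-/
lemma rpow_le_blockTime (j : ℕ) : (j : ℝ) ^ (5 / 4 : ℝ) ≤ blockTime j := by
  induction j with
  | zero => simp [blockTime_zero]
  | succ j ih =>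
    rw [blockTime_succ]
    push_cast
    rcases Nat.eq_zero_or_pos j with rfl | hj
    · simp [blockTime_zero, blockLen]
    have hj0 : (1 : ℝ) ≤ j := by exact_mod_cast hj
    have h1 := le_blockLen j
    set y := (j : ℝ) ^ (1 / 4 : ℝ) with hy
    have hy0 : 0 ≤ y := by positivity
    have h2 : ((j : ℝ) + 1) ^ (1 / 4 : ℝ) ≤ y * (1 + 1 / j) := by
      have e1 : (j : ℝ) + 1 = j * (1 + 1 / j) := by field_simp
      rw [e1, Real.mul_rpow (by positivity) (by positivity)]
      refine mul_le_mul_of_nonneg_left ?_ hy0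
      conv_rhs => rw [← Real.rpow_one (1 + 1 / (j : ℝ))]
      refine Real.rpow_le_rpow_of_exponent_le ?_ (by norm_num)
      have : 0 ≤ 1 / (j : ℝ) := by positivity
      linarith
    rw [rpow_five_fourths (by positivity)] at ih ⊢
    have h3 : ((j : ℝ) + 1) * ((j : ℝ) + 1) ^ (1 / 4 : ℝ) ≤ ((j : ℝ) + 1) * (y * (1 + 1 / j)) :=
      mul_le_mul_of_nonneg_left h2 (by linarith)
    have h4 : ((j : ℝ) + 1) * (y * (1 + 1 / j)) = y * (j + 2 + 1 / j) := by field_simp; ring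
    have h5 : 1 / (j : ℝ) ≤ 1 := by rw [div_le_one (by linarith)]; exact hj0
    nlinarith

lemma blockTime_succ_le {j : ℕ} (hj : 1 ≤ j) :
    (blockTime (j + 1) : ℝ) ≤ 28 * (j : ℝ) ^ (5 / 4 : ℝ) := by
  have hj0 : (1 : ℝ) ≤ j := by exact_mod_cast hj
  have h1 : blockTime (j + 1) ≤ (j + 1) * blockLen j := by
    have := Finset.sum_le_card_nsmul (Finset.range (j + 1)) blockLen (blockLen j) fun i hi =>
      blockLen_mono (Nat.lt_succ_iff.1 (Finset.mem_range.1 hi))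
    simpa [blockTime] using this
  have h2 : (blockTime (j + 1) : ℝ) ≤ (j + 1) * blockLen j := by exact_mod_cast h1
  have h3 := blockLen_le hj
  rw [rpow_five_fourths (by linarith)]
  have hy : 0 ≤ (j : ℝ) ^ (1 / 4 : ℝ) := by positivity
  nlinarith

lemma slow_le_of_lt_blockTime {j n : ℕ} (hj : 1 ≤ j) (hn : n < blockTime (j + 1)) :
    slow n ≤ 28 * (j : ℝ) ^ (1 / 8 : ℝ) := by
  have h1 : (n : ℝ) ≤ 28 * (j : ℝ) ^ (5 / 4 : ℝ) :=
    le_trans (by exact_mod_cast hn.le) (blockTime_succ_le hj)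
  have h2 : slow n ≤ (28 * (j : ℝ) ^ (5 / 4 : ℝ)) ^ (1 / 10 : ℝ) :=
    Real.rpow_le_rpow (Nat.cast_nonneg _) h1 (by norm_num)
  rw [Real.mul_rpow (by norm_num) (by positivity), ← Real.rpow_mul (Nat.cast_nonneg _)] at h2
  have h3 : (28 : ℝ) ^ (1 / 10 : ℝ) ≤ 28 := by
    conv_rhs => rw [← Real.rpow_one 28]
    exact Real.rpow_le_rpow_of_exponent_le (by norm_num) (by norm_num)
  have h4 : (5 / 4 * (1 / 10) : ℝ) = 1 / 8 := by norm_num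
  rw [h4] at h2
  exact h2.trans (mul_le_mul_of_nonneg_right h3 (by positivity))

/-- In block `j` the time is of order $j^{5/4}$. There caps and windows are of order $j^{1/8}$,
block lengths $j^{1/4}$ and isolation distances $j^{5/16}$, in increasing order. -/
lemma blockCalibrated_eventually {ε : ℝ} (hε : 0 < ε) :
    ∀ᶠ j₀ in atTop, BlockCalibrated capE windowLen gapLen ε j₀ := by
  have e1 := eventually_mul_rpow_le (1 / ε) (show (1 / 8 : ℝ) < 1 / 4 by norm_num)
  have e2 := eventually_mul_rpow_le 14 (show (1 / 4 : ℝ) < 5 / 16 by norm_num)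
  have e3 := eventually_mul_rpow_le 58 (show (1 / 8 : ℝ) < 1 / 4 by norm_num)
  obtain ⟨N, hN⟩ := eventually_atTop.1 (e1.and (e2.and e3))
  filter_upwards [eventually_ge_atTop N, eventually_ge_atTop 2] with j₀ hj₀ htwo
  refine ⟨fun j n hj hn => ?_, fun j b hj hb => ?_, fun j n hj hn1 hn2 => ?_⟩
  · have h1 := (hN j (hj₀.trans hj)).1
    have h2 := slow_le_of_lt_blockTime (by omega) hn
    have h3 := le_blockLen j
    rw [div_mul_eq_mul_div, div_le_iff₀ hε, one_mul] at h1
    rw [capE]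
    have h4 := mul_le_mul_of_nonneg_left h3 hε.le
    have h5 : 0 ≤ (j : ℝ) ^ (1 / 8 : ℝ) := by positivity
    linarith
  · have h1 := (hN j (hj₀.trans hj)).2.1
    have h2 := blockLen_le (show 1 ≤ j by omega)
    refine Nat.le_floor (h2.trans (h1.trans ?_))
    have h3 : (j : ℝ) ^ (5 / 4 : ℝ) ≤ b := (rpow_le_blockTime j).trans (by exact_mod_cast hb)
    have h4 := Real.rpow_le_rpow (by positivity) h3 (show (0 : ℝ) ≤ 1 / 4 by norm_num)
    rw [← Real.rpow_mul (Nat.cast_nonneg _)] at h4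
    norm_num at h4 ⊢
    exact h4
  · have h1 := (hN j (hj₀.trans hj)).2.2
    have h2 := slow_le_of_lt_blockTime (show 1 ≤ j by omega) hn2
    have h3 := windowLen_le n
    have h4 := le_blockLen (j - 1)
    have h5 : (j : ℝ) ^ (1 / 4 : ℝ) ≤ 2 * ((j - 1 : ℕ) : ℝ) ^ (1 / 4 : ℝ) := by
      have e1 : (j : ℝ) ≤ 2 * ((j - 1 : ℕ) : ℝ) := by exact_mod_cast (show j ≤ 2 * (j - 1) by omega)
      have e2 := Real.rpow_le_rpow (Nat.cast_nonneg _) e1 (show (0 : ℝ) ≤ 1 / 4 by norm_num)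
      rw [Real.mul_rpow (by norm_num) (by positivity)] at e2
      have e3 : (2 : ℝ) ^ (1 / 4 : ℝ) ≤ 2 := by
        conv_rhs => rw [← Real.rpow_one 2]
        exact Real.rpow_le_rpow_of_exponent_le (by norm_num) (by norm_num)
      exact e2.trans (mul_le_mul_of_nonneg_right e3 (by positivity))
    have h6 : (1 : ℝ) ≤ (j : ℝ) ^ (1 / 8 : ℝ) :=
      Real.one_le_rpow (by exact_mod_cast (show 1 ≤ j by omega)) (by norm_num)
    have : (2 * windowLen n : ℝ) ≤ blockLen (j - 1) := by linarith
    exact_mod_cast this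

lemma badProb_eq {n : ℕ} (hn : 1 ≤ n) : badProb n = 6 * (n : ℝ) ^ (-(9 / 10) : ℝ) := by
  have hn0 : (0 : ℝ) < n := by exact_mod_cast hn
  rw [badProb, slow, mul_div_assoc, ← Real.rpow_sub_one hn0.ne']
  norm_num

lemma badProb_antitone {a b : ℕ} (ha : 1 ≤ a) (hab : a ≤ b) : badProb b ≤ badProb a := by
  rw [badProb_eq ha, badProb_eq (ha.trans hab)]
  exact mul_le_mul_of_nonneg_left (Real.rpow_le_rpow_of_nonpos (by exact_mod_cast ha)
    (by exact_mod_cast hab) (by norm_num)) (by norm_num)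

/-! ### Failure probabilities and their summability. -/

lemma exists_rate_lower {η : ℝ} (hη : 0 < η) :
    ∃ c > 0, ∀ k : ℕ, Real.exp (η * ((1 - η) * k)) * (1 / (1 + η)) ^ k ≤ Real.exp (-c * k) := by
  refine ⟨η / (1 + η) - η * (1 - η), ?_, fun k => ?_⟩
  · have : η / (1 + η) - η * (1 - η) = η ^ 3 / (1 + η) := by field_simp; ring
    rw [this]; positivity
  · have h1 : 1 / (1 + η) ≤ Real.exp (-(η / (1 + η))) := by
      have := Real.add_one_le_exp (-(η / (1 + η)))
      have e : -(η / (1 + η)) + 1 = 1 / (1 + η) := by field_simp; ring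
      linarith
    refine (mul_le_mul_of_nonneg_left (pow_le_pow_left₀ (by positivity) h1 k)
      (Real.exp_pos _).le).trans_eq ?_
    rw [← Real.exp_nat_mul, ← Real.exp_add]
    congr 1; ring

lemma exists_rate_upper {ε : ℝ} (hε : 0 < ε) : ∃ t : ℝ, 0 ≤ t ∧ t < 1 ∧ ∃ c > 0, ∀ k : ℕ,
    Real.exp (-t * ((1 + ε) * k)) * (1 / (1 - t)) ^ k ≤ Real.exp (-c * k) := by
  -- Half the optimal exponent `ε / (1 + ε)`, so that the rate stays strictly positive after `1 / (1
  -- - t)` is bounded by an exponential.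
  set t := ε / (2 * (1 + ε)) with ht
  have e0 : 1 - t = (2 + ε) / (2 * (1 + ε)) := by rw [ht]; field_simp; ring
  have ht1 : 0 < 1 - t := by rw [e0]; positivity
  have ht0 : 0 < t := by rw [ht]; positivity
  refine ⟨t, ht0.le, by linarith, t * (1 + ε) - t / (1 - t), ?_, fun k => ?_⟩
  · rw [e0, gt_iff_lt, sub_pos, div_lt_iff₀ (by positivity)]
    have : t * (1 + ε) * ((2 + ε) / (2 * (1 + ε))) = t * (1 + ε / 2) := by field_simp
    rw [this]
    nlinarith
  · have h1 : 1 / (1 - t) ≤ Real.exp (t / (1 - t)) := by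
      have := Real.add_one_le_exp (t / (1 - t))
      have e : t / (1 - t) + 1 = 1 / (1 - t) := by field_simp; ring
      linarith
    refine (mul_le_mul_of_nonneg_left (pow_le_pow_left₀ (by positivity) h1 k)
      (Real.exp_pos _).le).trans_eq ?_
    rw [← Real.exp_nat_mul, ← Real.exp_add]
    congr 1; ring

lemma summable_exp_neg_mul_rpow {c p : ℝ} (hc : 0 < c) (hp : 0 < p) :
    Summable fun n : ℕ => Real.exp (-c * (n : ℝ) ^ p) := by
  have h := ((isLittleO_exp_neg_mul_rpow_atTop hc (-2 / p)).comp_tendsto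
    (tendsto_rpow_atTop hp)).comp_tendsto tendsto_natCast_atTop_atTop
  refine summable_of_isBigO_nat (Real.summable_nat_rpow.2 (show (-2 : ℝ) < -1 by norm_num))
    (h.isBigO.congr_right fun n => ?_)
  simp only [Function.comp_apply]
  rw [← Real.rpow_mul (Nat.cast_nonneg _)]
  congr 1; field_simp

/-- A bound for the probability that the driving variables misbehave at time `n`. -/
noncomputable def stepFailure (n : ℕ) : ℝ :=
  2 * Real.exp (-(1 / 200) * (n : ℝ) ^ (1 / 10 : ℝ)) + 144 * (n : ℝ) ^ (-(31 / 20) : ℝ)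
    + 12 * (n : ℝ) ^ (-(17 / 10) : ℝ)

/-- A bound for the probability that the driving variables misbehave in block `j`. -/
noncomputable def blockFailure (c c' : ℝ) (j : ℕ) : ℝ :=
  12 * (j : ℝ) ^ (-(9 / 8) : ℝ) + Real.exp (-c * (j : ℝ) ^ (1 / 4 : ℝ))
    + Real.exp (-c' * (j : ℝ) ^ (1 / 4 : ℝ))

lemma summable_stepFailure : Summable stepFailure :=
  (((summable_exp_neg_mul_rpow (by norm_num) (by norm_num)).mul_left 2).add
    ((Real.summable_nat_rpow.2 (by norm_num)).mul_left 144)).add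
    ((Real.summable_nat_rpow.2 (by norm_num)).mul_left 12)

lemma summable_blockFailure {c c' : ℝ} (hc : 0 < c) (hc' : 0 < c') :
    Summable (blockFailure c c') :=
  (((Real.summable_nat_rpow.2 (by norm_num)).mul_left 12).add
    (summable_exp_neg_mul_rpow hc (by norm_num))).add
    (summable_exp_neg_mul_rpow hc' (by norm_num))

/-- The event that `U n` is close to an end of the unit interval. -/
def extremeSet {Ω : Type*} (U : ℕ → Ω → ℝ) (n : ℕ) : Set Ω :=
  {ω | ¬ (badProb n < U n ω ∧ U n ω < 1 - badProb n)}

/-- The event that the driving variables misbehave at time `n`. -/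
def stepFailureSet {Ω : Type*} (E U : ℕ → Ω → ℝ) (n : ℕ) : Set Ω :=
  ({ω | E n ω ≤ 0} ∪ {ω | capE n < E n ω}) ∪
    ({ω | ∑ i ∈ Finset.Ico (n - windowLen n) n, E i ω ≤ 11 * capE n} ∪
    ((⋃ b ∈ Finset.Ioc n (n + gapLen n), extremeSet U n ∩ extremeSet U b) ∪
      (extremeSet U n ∩ {ω | E (n + 1) ω ≤ smallE n})))

/-- The event that the driving variables misbehave in block `j`. -/
def blockFailureSet {Ω : Type*} (E U : ℕ → Ω → ℝ) (ε : ℝ) (j : ℕ) : Set Ω :=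
  extremeSet U (blockTime (j + 1) - 1) ∪
    ({ω | ∑ i ∈ Finset.Ico (blockTime j) (blockTime (j + 1)), E i ω ≤ (1 - ε / 3) * blockLen j} ∪
    {ω | (1 + ε) * blockLen j ≤ ∑ i ∈ Finset.Ico (blockTime j) (blockTime (j + 1)), E i ω})

lemma smallE_eq {n : ℕ} (hn : 1 ≤ n) : smallE n = (n : ℝ) ^ (-(8 / 10) : ℝ) := by
  have hn0 : (0 : ℝ) < n := by exact_mod_cast hn
  rw [smallE, slow, ← Real.rpow_natCast, ← Real.rpow_mul hn0.le, ← Real.rpow_sub_one hn0.ne']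
  norm_num

lemma badProb_nonneg (n : ℕ) : 0 ≤ badProb n :=
  div_nonneg (mul_nonneg (by norm_num) (slow_nonneg n)) (Nat.cast_nonneg _)

lemma smallE_nonneg (n : ℕ) : 0 ≤ smallE n :=
  div_nonneg (sq_nonneg _) (Nat.cast_nonneg _)

namespace IsDriving

variable {Ω : Type*} [MeasurableSpace Ω] {P : Measure Ω} {E U : ℕ → Ω → ℝ}
  (D : IsDriving P E U)

include D

lemma measure_extremeSet (n : ℕ) :
    P (extremeSet U n) ≤ ENNReal.ofReal (2 * badProb n) :=
  D.measure_U_extreme n (badProb_nonneg n)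

lemma measure_extremeSet_inter {n m : ℕ} (hnm : n ≠ m) :
    P (extremeSet U n ∩ extremeSet U m) = P (extremeSet U n) * P (extremeSet U m) :=
  D.measure_inter_UU hnm
    (A := {x | ¬ (badProb n < x ∧ x < 1 - badProb n)})
    (B := {x | ¬ (badProb m < x ∧ x < 1 - badProb m)})
    (measurableSet_Ioo (a := badProb n) (b := 1 - badProb n)).compl
    (measurableSet_Ioo (a := badProb m) (b := 1 - badProb m)).compl

lemma measure_window [IsProbabilityMeasure P] {n : ℕ} (hn : windowLen n ≤ n) :
    P {ω | ∑ i ∈ Finset.Ico (n - windowLen n) n, E i ω ≤ 11 * capE n}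
      ≤ ENNReal.ofReal (Real.exp (-(1 / 200) * slow n)) := by
  refine (D.measure_sum_le _ _ zero_le_one).trans (ENNReal.ofReal_le_ofReal ?_)
  rw [Nat.card_Ico, Nat.sub_sub_self hn]
  have h1 : (1 / (1 + 1) : ℝ) ≤ Real.exp (-(1 / 2)) := by
    have := Real.add_one_le_exp (-(1 / 2) : ℝ)
    linarith
  refine (mul_le_mul_of_nonneg_left (pow_le_pow_left₀ (by norm_num) h1 _)
    (Real.exp_pos _).le).trans ?_
  rw [← Real.exp_nat_mul, ← Real.exp_add, Real.exp_le_exp, capE]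
  have := le_windowLen n
  have := slow_nonneg n
  linarith

/-- A time is bad with probability at most $12n^{-9/10}$. A second bad time among the next $n^{1/4}$
gives $144\,n^{1/4-18/10}$; a subsequent area below $n^{-8/10}$ gives $12n^{-17/10}$. -/
lemma measure_stepFailureSet [IsProbabilityMeasure P] {n : ℕ} (hn1 : 1 ≤ n)
    (hn : windowLen n ≤ n) :
    P (stepFailureSet E U n) ≤ ENNReal.ofReal (stepFailure n) := by
  have hn0 : (0 : ℝ) < n := by exact_mod_cast hn1
  have hθ := badProb_nonneg n
  have h1 : P ({ω | E n ω ≤ 0} ∪ {ω | capE n < E n ω})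
      ≤ ENNReal.ofReal (Real.exp (-(1 / 200) * slow n)) := by
    refine (measure_union_le _ _).trans_eq ?_
    rw [D.measure_E_nonpos, zero_add, D.measure_lt_E n (x := capE n)
      (div_nonneg (slow_nonneg n) (by norm_num)),
      capE]
    congr 2; ring
  have h3 : P (⋃ b ∈ Finset.Ioc n (n + gapLen n), extremeSet U n ∩ extremeSet U b)
      ≤ ENNReal.ofReal (144 * (n : ℝ) ^ (-(31 / 20) : ℝ)) := by
    refine (measure_biUnion_finset_le _ _).trans ?_
    have : ∀ b ∈ Finset.Ioc n (n + gapLen n), P (extremeSet U n ∩ extremeSet U b)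
        ≤ ENNReal.ofReal ((2 * badProb n) * (2 * badProb n)) := fun b hb => by
      rw [Finset.mem_Ioc] at hb
      rw [D.measure_extremeSet_inter hb.1.ne, ENNReal.ofReal_mul (by linarith)]
      refine mul_le_mul' (D.measure_extremeSet n) ((D.measure_extremeSet b).trans ?_)
      exact ENNReal.ofReal_le_ofReal (by linarith [badProb_antitone hn1 hb.1.le])
    refine (Finset.sum_le_card_nsmul _ _ _ this).trans ?_
    rw [Nat.card_Ioc, Nat.add_sub_cancel_left, nsmul_eq_mul, ← ENNReal.ofReal_natCast,
      ← ENNReal.ofReal_mul (Nat.cast_nonneg _)]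
    refine ENNReal.ofReal_le_ofReal ?_
    have hg : (gapLen n : ℝ) ≤ (n : ℝ) ^ (1 / 4 : ℝ) := Nat.floor_le (by positivity)
    refine (mul_le_mul_of_nonneg_right hg (by positivity)).trans_eq ?_
    rw [badProb_eq hn1]
    have e : (n : ℝ) ^ (-(31 / 20) : ℝ) = (n : ℝ) ^ (1 / 4 : ℝ) *
        ((n : ℝ) ^ (-(9 / 10) : ℝ) * (n : ℝ) ^ (-(9 / 10) : ℝ)) := by
      rw [← Real.rpow_add hn0, ← Real.rpow_add hn0]; norm_num
    rw [e]; ring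
  have h4 : P (extremeSet U n ∩ {ω | E (n + 1) ω ≤ smallE n})
      ≤ ENNReal.ofReal (12 * (n : ℝ) ^ (-(17 / 10) : ℝ)) := by
    have := D.measure_inter_UE n (n + 1)
      (A := {x | ¬ (badProb n < x ∧ x < 1 - badProb n)}) (B := Set.Iic (smallE n))
      (measurableSet_Ioo (a := badProb n) (b := 1 - badProb n)).compl measurableSet_Iic
    refine this.trans_le ((mul_le_mul' (D.measure_extremeSet n)
      (D.measure_E_le_le (n + 1) (smallE_nonneg n))).trans_eq ?_)
    rw [← ENNReal.ofReal_mul (by linarith), badProb_eq hn1, smallE_eq hn1]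
    have e : (n : ℝ) ^ (-(17 / 10) : ℝ)
        = (n : ℝ) ^ (-(9 / 10) : ℝ) * (n : ℝ) ^ (-(8 / 10) : ℝ) := by
      rw [← Real.rpow_add hn0]; norm_num
    rw [e]
    congr 1; ring
  refine ((measure_union_le _ _).trans (add_le_add h1 ((measure_union_le _ _).trans
    (add_le_add (D.measure_window hn) ((measure_union_le _ _).trans
      (add_le_add h3 h4)))))).trans_eq ?_
  rw [← ENNReal.ofReal_add (by positivity) (by positivity),
    ← ENNReal.ofReal_add (by positivity) (by positivity),
    ← ENNReal.ofReal_add (by positivity) (by positivity), stepFailure]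
  simp only [slow]
  congr 1; ring

lemma measure_blockFailureSet [IsProbabilityMeasure P] {ε t c c' : ℝ} (hε : 0 < ε) (ht : 0 ≤ t)
    (ht1 : t < 1) (hc : 0 < c) (hc' : 0 < c')
    (hlow : ∀ k : ℕ, Real.exp (ε / 3 * ((1 - ε / 3) * k)) * (1 / (1 + ε / 3)) ^ k
      ≤ Real.exp (-c * k))
    (hup : ∀ k : ℕ, Real.exp (-t * ((1 + ε) * k)) * (1 / (1 - t)) ^ k ≤ Real.exp (-c' * k))
    {j : ℕ} (hj : 1 ≤ j) :
    P (blockFailureSet E U ε j) ≤ ENNReal.ofReal (blockFailure c c' j) := by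
  have hj0 : (0 : ℝ) < j := by exact_mod_cast hj
  have hlen : (j : ℝ) ^ (1 / 4 : ℝ) ≤ blockLen j := by
    have := le_blockLen j
    have : (0 : ℝ) ≤ (j : ℝ) ^ (1 / 4 : ℝ) := by positivity
    linarith
  have hcard : (Finset.Ico (blockTime j) (blockTime (j + 1))).card = blockLen j := by
    rw [Nat.card_Ico, blockTime_succ, Nat.add_sub_cancel_left]
  have h1 : P (extremeSet U (blockTime (j + 1) - 1))
      ≤ ENNReal.ofReal (12 * (j : ℝ) ^ (-(9 / 8) : ℝ)) := by
    refine (D.measure_extremeSet _).trans (ENNReal.ofReal_le_ofReal ?_)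
    have hpos := blockTime_pos hj
    have hlt : blockTime j < blockTime (j + 1) := blockTime_strictMono (Nat.lt_succ_self j)
    have e1 := badProb_antitone hpos (show blockTime j ≤ blockTime (j + 1) - 1 by omega)
    rw [badProb_eq hpos] at e1
    have e2 := Real.rpow_le_rpow_of_nonpos (by positivity) (rpow_le_blockTime j)
      (show (-(9 / 10) : ℝ) ≤ 0 by norm_num)
    rw [← Real.rpow_mul hj0.le] at e2
    norm_num at e1 e2 ⊢
    linarith
  have h2 := D.measure_sum_le (Finset.Ico (blockTime j) (blockTime (j + 1)))
    ((1 - ε / 3) * blockLen j) (show 0 ≤ ε / 3 by linarith)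
  have h3 := D.measure_le_sum (Finset.Ico (blockTime j) (blockTime (j + 1)))
    ((1 + ε) * blockLen j) ht ht1
  rw [hcard] at h2 h3
  have h2' := h2.trans (ENNReal.ofReal_le_ofReal ((hlow _).trans
    (Real.exp_le_exp.2 (show -c * (blockLen j : ℝ) ≤ -c * (j : ℝ) ^ (1 / 4 : ℝ) by
      nlinarith))))
  have h3' := h3.trans (ENNReal.ofReal_le_ofReal ((hup _).trans
    (Real.exp_le_exp.2 (show -c' * (blockLen j : ℝ) ≤ -c' * (j : ℝ) ^ (1 / 4 : ℝ) by
      nlinarith))))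
  refine ((measure_union_le _ _).trans (add_le_add h1 ((measure_union_le _ _).trans
    (add_le_add h2' h3')))).trans_eq ?_
  rw [← ENNReal.ofReal_add (by positivity) (by positivity),
    ← ENNReal.ofReal_add (by positivity) (by positivity), blockFailure]
  congr 1; ring

end IsDriving

/-! ### The tail event. -/

/-- The event that the driving variables are typical from time `blockTime j₀` on. -/
def tailEvent {Ω : Type*} (E U : ℕ → Ω → ℝ) (ε : ℝ) (j₀ : ℕ) : Set Ω :=
  {ω | TypicalTail (fun n => E n ω) (fun n => U n ω) capE badProb smallE windowLen gapLen ε j₀}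

lemma compl_tailEvent_subset {Ω : Type*} (E U : ℕ → Ω → ℝ) (ε : ℝ) (j₀ : ℕ) :
    (tailEvent E U ε j₀)ᶜ ⊆ (⋃ k, stepFailureSet E U (k + blockTime j₀)) ∪
      ⋃ k, blockFailureSet E U ε (k + j₀) := by
  intro ω hω
  by_contra hcon
  rw [Set.mem_union, not_or, Set.mem_iUnion, Set.mem_iUnion, not_exists, not_exists] at hcon
  obtain ⟨hs, hb⟩ := hcon
  have hs' : ∀ n, blockTime j₀ ≤ n → ω ∉ stepFailureSet E U n := fun n hn => by
    have := hs (n - blockTime j₀)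
    rwa [Nat.sub_add_cancel hn] at this
  have hb' : ∀ j, j₀ ≤ j → ω ∉ blockFailureSet E U ε j := fun j hj => by
    have := hb (j - j₀)
    rwa [Nat.sub_add_cancel hj] at this
  simp only [stepFailureSet, Set.mem_union, not_or, Set.mem_iUnion, not_exists] at hs'
  simp only [blockFailureSet, Set.mem_union, not_or] at hb'
  refine hω ⟨fun n hn => not_le.1 (hs' n hn).1.1, fun n hn => not_lt.1 (hs' n hn).1.2,
    fun n hn => (not_le.1 (hs' n (hn.trans (Nat.sub_le _ _))).2.1).le,
    fun b hb b' hbb hbad => (hs' b hb).2.2.1 b' hbb ⟨hbad.1.2, hbad.2.2⟩,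
    fun b hb hbad => (hs' b hb).2.2.2 ⟨hbad.1.2, hbad.2⟩,
    fun j hj hbad => (hb' j hj).1 hbad.2,
    fun j hj => (not_le.1 (hb' j hj).2.1).le, fun j hj => (not_le.1 (hb' j hj).2.2).le⟩

/-- Measurability of the coordinates is assumed from `blockTime j₀` on only, so that the lemma also
applies to the σ-algebra generated by these coordinates. This is what `indep_head_tail` needs. -/
lemma measurableSet_tailEvent {Ω : Type*} [MeasurableSpace Ω] {E U : ℕ → Ω → ℝ} {ε : ℝ} {j₀ : ℕ}
    (hE : ∀ n, blockTime j₀ ≤ n → Measurable (E n))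
    (hU : ∀ n, blockTime j₀ ≤ n → Measurable (U n)) : MeasurableSet (tailEvent E U ε j₀) := by
  have hbad : ∀ n, MeasurableSet {ω | IsBad badProb (fun n => U n ω) (blockTime j₀) n} := by
    intro n
    by_cases hn : blockTime j₀ ≤ n
    · have : {ω | IsBad badProb (fun n => U n ω) (blockTime j₀) n}
          = (U n ⁻¹' Set.Ioo (badProb n) (1 - badProb n))ᶜ := by
        ext ω
        simp [IsBad, hn]
      rw [this]
      exact (hU n hn measurableSet_Ioo).compl
    · have : {ω | IsBad badProb (fun n => U n ω) (blockTime j₀) n} = ∅ := by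
        ext ω
        simp [IsBad, hn]
      rw [this]
      exact MeasurableSet.empty
  have hsum : ∀ a b, blockTime j₀ ≤ a → Measurable fun ω => ∑ i ∈ Finset.Ico a b, E i ω :=
    fun a b ha => Finset.measurable_fun_sum _ fun i hi =>
      hE i (ha.trans (Finset.mem_Ico.1 hi).1)
  have hmono := blockTime_strictMono.monotone
  have heq : tailEvent E U ε j₀ =
      (⋂ n, ⋂ (_ : blockTime j₀ ≤ n), {ω | 0 < E n ω}) ∩
      (⋂ n, ⋂ (_ : blockTime j₀ ≤ n), {ω | E n ω ≤ capE n}) ∩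
      (⋂ n, ⋂ (_ : blockTime j₀ ≤ n - windowLen n),
        {ω | 11 * capE n ≤ ∑ i ∈ Finset.Ico (n - windowLen n) n, E i ω}) ∩
      (⋂ b, ⋂ (_ : blockTime j₀ ≤ b), ⋂ b' ∈ Finset.Ioc b (b + gapLen b),
        ({ω | IsBad badProb (fun n => U n ω) (blockTime j₀) b} ∩
          {ω | IsBad badProb (fun n => U n ω) (blockTime j₀) b'})ᶜ) ∩
      (⋂ b, ⋂ (_ : blockTime j₀ ≤ b),
        ({ω | IsBad badProb (fun n => U n ω) (blockTime j₀) b} ∩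
          {ω | E (b + 1) ω ≤ smallE b})ᶜ) ∩
      (⋂ j, ⋂ (_ : j₀ ≤ j),
        {ω | IsBad badProb (fun n => U n ω) (blockTime j₀) (blockTime (j + 1) - 1)}ᶜ) ∩
      (⋂ j, ⋂ (_ : j₀ ≤ j), {ω | (1 - ε / 3) * blockLen j ≤
        ∑ i ∈ Finset.Ico (blockTime j) (blockTime (j + 1)), E i ω}) ∩
      (⋂ j, ⋂ (_ : j₀ ≤ j), {ω |
        ∑ i ∈ Finset.Ico (blockTime j) (blockTime (j + 1)), E i ω ≤ (1 + ε) * blockLen j}) := by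
    ext ω
    simp only [Set.mem_inter_iff, Set.mem_iInter, Set.mem_compl_iff]
    constructor
    · rintro ⟨h1, h2, h3, h4, h5, h6, h7, h8⟩
      exact ⟨⟨⟨⟨⟨⟨⟨h1, h2⟩, h3⟩, h4⟩, h5⟩, h6⟩, h7⟩, h8⟩
    · rintro ⟨⟨⟨⟨⟨⟨⟨h1, h2⟩, h3⟩, h4⟩, h5⟩, h6⟩, h7⟩, h8⟩
      exact ⟨h1, h2, h3, h4, h5, h6, h7, h8⟩
  rw [heq]
  refine MeasurableSet.inter (MeasurableSet.inter (MeasurableSet.inter (MeasurableSet.inter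
    (MeasurableSet.inter (MeasurableSet.inter (MeasurableSet.inter ?_ ?_) ?_) ?_) ?_) ?_) ?_) ?_
  · exact .iInter fun n => .iInter fun hn => measurableSet_lt measurable_const (hE n hn)
  · exact .iInter fun n => .iInter fun hn => measurableSet_le (hE n hn) measurable_const
  · exact .iInter fun n => .iInter fun hn => measurableSet_le measurable_const (hsum _ _ hn)
  · exact .iInter fun b => .iInter fun hb => .iInter fun b' => .iInter fun _ =>
      ((hbad b).inter (hbad b')).compl
  · exact .iInter fun b => .iInter fun hb =>
      ((hbad b).inter (measurableSet_le (hE (b + 1) (by omega)) measurable_const)).compl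
  · exact .iInter fun j => .iInter fun _ => (hbad _).compl
  · exact .iInter fun j => .iInter fun hj =>
      measurableSet_le measurable_const (hsum _ _ (hmono hj))
  · exact .iInter fun j => .iInter fun hj =>
      measurableSet_le (hsum _ _ (hmono hj)) measurable_const

/-- The tail of the driving sequence is typical with probability at least `1/2`, from a time on
that does not depend on the probability space. -/
lemma exists_half_le_measure_tailEvent {ε : ℝ} (hε : 0 < ε) :
    ∀ᶠ j₀ in atTop, (∀ n, blockTime j₀ ≤ n → windowLen n ≤ n) →
      ∀ (Ω : Type*) [MeasurableSpace Ω] (P : Measure Ω) [IsProbabilityMeasure P]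
        (E U : ℕ → Ω → ℝ), IsDriving P E U → 1 / 2 ≤ P (tailEvent E U ε j₀) := by
  obtain ⟨c, hc, hlow⟩ := exists_rate_lower (show 0 < ε / 3 by linarith)
  obtain ⟨t, ht, ht1, c', hc', hup⟩ := exists_rate_upper hε
  have hs := ENNReal.tendsto_sum_nat_add (fun n => ENNReal.ofReal (stepFailure n))
    summable_stepFailure.tsum_ofReal_ne_top
  have hb := ENNReal.tendsto_sum_nat_add (fun j => ENNReal.ofReal (blockFailure c c' j))
    (summable_blockFailure hc hc').tsum_ofReal_ne_top
  have hsum := (hs.comp blockTime_strictMono.tendsto_atTop).add hb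
  rw [add_zero] at hsum
  have hev := hsum.eventually (ge_mem_nhds (show (0 : ENNReal) < 1 / 2 by norm_num))
  filter_upwards [hev, eventually_ge_atTop 1] with j₀ hj₀ hj1 hwin Ω _ P _ E U D
  have hpos := blockTime_pos hj1
  have hcompl : P (tailEvent E U ε j₀)ᶜ ≤ 1 / 2 := by
    refine (measure_mono (compl_tailEvent_subset E U ε j₀)).trans
      ((measure_union_le _ _).trans (le_trans ?_ hj₀))
    refine add_le_add ((measure_iUnion_le _).trans (ENNReal.tsum_le_tsum fun k => ?_))
      ((measure_iUnion_le _).trans (ENNReal.tsum_le_tsum fun k => ?_))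
    · exact D.measure_stepFailureSet (by omega) (hwin _ (by omega))
    · exact D.measure_blockFailureSet hε ht ht1 hc hc' hlow hup (by omega)
  have hm := measurableSet_tailEvent (ε := ε) (j₀ := j₀) (fun n _ => D.measurable_E n)
    (fun n _ => D.measurable_U n)
  rw [prob_compl_eq_one_sub hm] at hcompl
  have h2 : (1 : ENNReal) ≤ 1 / 2 + P (tailEvent E U ε j₀) := tsub_le_iff_right.1 hcompl
  have h3 : (1 : ENNReal) / 2 + 1 / 2 ≤ 1 / 2 + P (tailEvent E U ε j₀) := by
    rwa [ENNReal.add_halves]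
  exact (ENNReal.add_le_add_iff_left (by norm_num)).1 h3

/-! ### The head event and its independence of the tail. -/

lemma expMeasure_Icc_pos {a b : ℝ} (ha : 0 ≤ a) (hab : a < b) :
    0 < expMeasure 1 (Set.Icc a b) := by
  have := isProbabilityMeasure_expMeasure one_pos
  refine lt_of_lt_of_le ?_ (measure_mono (Set.Ioc_subset_Icc_self))
  rw [← Set.Iic_sdiff_Iic, measure_sdiff (Set.Iic_subset_Iic.2 hab.le)
    measurableSet_Iic.nullMeasurableSet (measure_ne_top _ _), expMeasure_one_Iic,
    expMeasure_one_Iic, if_pos ha, if_pos (ha.trans hab.le), tsub_pos_iff_lt]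
  refine (ENNReal.ofReal_lt_ofReal_iff ?_).2 ?_
  · have : Real.exp (-b) < 1 := Real.exp_lt_one_iff.2 (by linarith)
    linarith
  · have : Real.exp (-b) < Real.exp (-a) := Real.exp_lt_exp.2 (by linarith)
    linarith

/-- The event that `E 0 ∈ A`, that `E n ∈ I` for `1 ≤ n ≤ m`, and that `U n ∈ J` for `n ≤ m`. -/
def headEvent {Ω : Type*} (E U : ℕ → Ω → ℝ) (m : ℕ) (A I J : Set ℝ) : Set Ω :=
  ⋂ i ∈ (Finset.range (m + 1)).disjSum (Finset.range (m + 1)),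
    (Sum.elim E U : ℕ ⊕ ℕ → Ω → ℝ) i ⁻¹' Sum.elim (fun n => if n = 0 then A else I) (fun _ => J) i

lemma mem_headEvent {Ω : Type*} {E U : ℕ → Ω → ℝ} {m : ℕ} {A I J : Set ℝ} {ω : Ω}
    (h : ω ∈ headEvent E U m A I J) :
    E 0 ω ∈ A ∧ (∀ n, 1 ≤ n → n < m + 1 → E n ω ∈ I) ∧ ∀ n, n < m + 1 → U n ω ∈ J := by
  rw [headEvent, Set.mem_iInter₂] at h
  refine ⟨?_, fun n h1 h2 => ?_, fun n hn => ?_⟩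
  · have := h (Sum.inl 0) (Finset.inl_mem_disjSum.2 (Finset.mem_range.2 (by omega)))
    simpa using this
  · have := h (Sum.inl n) (Finset.inl_mem_disjSum.2 (Finset.mem_range.2 h2))
    simpa [show n ≠ 0 by omega] using this
  · have := h (Sum.inr n) (Finset.inr_mem_disjSum.2 (Finset.mem_range.2 hn))
    simpa using this

namespace IsDriving

variable {Ω : Type*} [MeasurableSpace Ω] {P : Measure Ω} {E U : ℕ → Ω → ℝ}
  (D : IsDriving P E U)

include D

lemma measure_headEvent (m : ℕ) {A I J : Set ℝ} (hA : MeasurableSet A) (hI : MeasurableSet I)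
    (hJ : MeasurableSet J) :
    P (headEvent E U m A I J)
      = expMeasure 1 A * expMeasure 1 I ^ m * volume (J ∩ Set.Ioo 0 1) ^ (m + 1) := by
  have h := iIndepFun_iff_measure_inter_preimage_eq_mul.1 D.indep
    ((Finset.range (m + 1)).disjSum (Finset.range (m + 1)))
    (sets := Sum.elim (fun n => if n = 0 then A else I) (fun _ => J)) (by
      rintro (n | n) -
      · simp only [Sum.elim_inl]
        split_ifs
        · exact hA
        · exact hI
      · exact hJ)
  rw [headEvent, h, Finset.prod_disjSum, Finset.prod_range_succ']
  have hE : ∀ n, ∀ B : Set ℝ, MeasurableSet B → P (E n ⁻¹' B) = expMeasure 1 B := fun n B hB => by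
    rw [← D.law_E n, Measure.map_apply (D.measurable_E n) hB]
  simp only [Sum.elim_inl, Sum.elim_inr, Nat.add_eq_zero_iff, one_ne_zero, and_false, if_false,
    if_true, hE _ _ hA, hE _ _ hI, D.measure_U_preimage _ hJ, Finset.prod_const,
    Finset.card_range]
  ring

lemma indep_head_tail {m : ℕ} {A I J : Set ℝ} (hA : MeasurableSet A)
    (hI : MeasurableSet I) (hJ : MeasurableSet J) {ε : ℝ} {j₀ : ℕ} (hm : blockTime j₀ = m + 1) :
    P (headEvent E U m A I J ∩ tailEvent E U ε j₀)
      = P (headEvent E U m A I J) * P (tailEvent E U ε j₀) := by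
  set f : ℕ ⊕ ℕ → Ω → ℝ := Sum.elim E U with hf
  set F : ℕ ⊕ ℕ → MeasurableSpace Ω := fun i => MeasurableSpace.comap (f i) inferInstance with hF
  set T : Set (ℕ ⊕ ℕ) := {i | m + 1 ≤ Sum.elim id id i}
  have hfm : ∀ i, Measurable (f i) := by
    rintro (n | n)
    · exact D.measurable_E n
    · exact D.measurable_U n
  have hind : Indep (⨆ i ∈ Tᶜ, F i) (⨆ i ∈ T, F i) P :=
    indep_iSup_of_disjoint (fun i => (hfm i).comap_le) D.indep disjoint_compl_left
  refine (Indep_iff _ _ P).1 hind _ _ ?_ ?_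
  · refine Finset.measurableSet_biInter _ fun i hi => ?_
    have hiT : i ∈ Tᶜ := by
      rcases i with n | n
      · have := Finset.mem_range.1 (Finset.inl_mem_disjSum.1 hi)
        simpa [T] using this
      · have := Finset.mem_range.1 (Finset.inr_mem_disjSum.1 hi)
        simpa [T] using this
    refine le_iSup₂_of_le (f := fun i (_ : i ∈ Tᶜ) => F i) i hiT le_rfl _ ⟨_, ?_, rfl⟩
    rcases i with n | n
    · simp only [Sum.elim_inl]
      split_ifs
      · exact hA
      · exact hI
    · exact hJ
  · refine @measurableSet_tailEvent Ω (⨆ i ∈ T, F i) E U ε j₀ (fun n hn => ?_) (fun n hn => ?_)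
    · exact measurable_iff_comap_le.2 (le_iSup₂_of_le (f := fun i (_ : i ∈ T) => F i) (Sum.inl n)
        (by simp only [T, Set.mem_ofPred_eq, Sum.elim_inl, id]; omega) le_rfl)
    · exact measurable_iff_comap_le.2 (le_iSup₂_of_le (f := fun i (_ : i ∈ T) => F i) (Sum.inr n)
        (by simp only [T, Set.mem_ofPred_eq, Sum.elim_inr, id]; omega) le_rfl)

end IsDriving

lemma measurableSet_radius_le {u : ℝ → ℝ} (H : UnimodalAt u 0 0) :
    MeasurableSet {e | u (radius e u) ≤ u (-radius e u)} :=
  measurableSet_le (H.measurable.comp H.radius_monotone.measurable)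
    (H.measurable.comp H.radius_monotone.measurable.neg)

lemma volume_Ioi_half : volume (Set.Ioi (1 / 2 : ℝ) ∩ Set.Ioo 0 1) = ENNReal.ofReal (1 / 2) := by
  have : Set.Ioi (1 / 2 : ℝ) ∩ Set.Ioo 0 1 = Set.Ioo (1 / 2) 1 := by
    ext x
    simp only [Set.mem_inter_iff, Set.mem_Ioi, Set.mem_Ioo]
    exact ⟨fun h => ⟨h.1, h.2.2⟩, fun h => ⟨h.1, by linarith [h.1], h.2⟩⟩
  rw [this, Real.volume_Ioo]
  norm_num

lemma volume_Iio_half : volume (Set.Iio (1 / 2 : ℝ) ∩ Set.Ioo 0 1) = ENNReal.ofReal (1 / 2) := by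
  have : Set.Iio (1 / 2 : ℝ) ∩ Set.Ioo 0 1 = Set.Ioo 0 (1 / 2) := by
    ext x
    simp only [Set.mem_inter_iff, Set.mem_Iio, Set.mem_Ioo]
    exact ⟨fun h => ⟨h.2.1, h.1⟩, fun h => ⟨h.2, h.1, by linarith [h.2]⟩⟩
  rw [this, Real.volume_Ioo]
  norm_num

end GreedyWalk

/-! ### Assembly of the two events. -/

open GreedyWalk in
theorem proposition1 (ε : ℝ) (hε : 0 < ε) :
    ∃ δ : ℝ, 0 < δ ∧
      ∀ (Ω : Type*) [MeasurableSpace Ω] (P : Measure Ω) [IsProbabilityMeasure P]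
        (E U : ℕ → Ω → ℝ), GreedyWalk.IsDriving P E U →
      ∀ u : ℝ → ℝ, GreedyWalk.IsPotential u → GreedyWalk.IsCentered u →
        GreedyWalk.IsUnimodal u →
      ∃ L : ℕ → Ω → ℕ,
        (∀ j, IsStoppingTime (GreedyWalk.history (GreedyWalk.walk u E U))
          (fun ω => (L j ω : WithTop ℕ))) ∧
        ENNReal.ofReal δ ≤ P {ω | ∀ j : ℕ, 1 ≤ j →
          GreedyWalk.GoodBlock ε u (fun n => GreedyWalk.walk u E U n ω) (fun i => L i ω) j} := by
  -- Head areas must stay below `2`, that is, `1 + ε' ≤ 2`.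
  set ε' := min ε 1 with hε'
  have hε0 : 0 < ε' := lt_min hε one_pos
  have hε1 : ε' ≤ 1 := min_le_right _ _
  obtain ⟨j₀, K, B, htail, hj₀⟩ := ((blockTime_strictMono.tendsto_atTop.eventually
    (calibrated_eventually (show 0 < ε' / 3 by linarith) (by linarith))).and
    ((blockCalibrated_eventually hε0).and ((exists_half_le_measure_tailEvent hε0).and
      (eventually_ge_atTop 1)))).exists
  replace htail := htail fun n hn => by have := K.w_lt n hn; omega
  obtain ⟨m, hm⟩ : ∃ m, blockTime j₀ = m + 1 :=
    ⟨blockTime j₀ - 1, by have := blockTime_pos hj₀; omega⟩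
  have := isProbabilityMeasure_expMeasure one_pos
  set p := expMeasure 1 (Set.Icc 2 3) with hp
  set q := expMeasure 1 (Set.Icc 1 (1 + ε')) ^ m * ENNReal.ofReal (1 / 2) ^ (m + 1) with hq
  have hp0 : 0 < p := expMeasure_Icc_pos (by norm_num) (by norm_num)
  have hq0 : q ≠ 0 := mul_ne_zero
    (pow_ne_zero _ (expMeasure_Icc_pos (by norm_num) (by linarith)).ne')
    (pow_ne_zero _ (by simp))
  have hfin : p * q * (1 / 2) ≠ ⊤ := ENNReal.mul_ne_top (ENNReal.mul_ne_top (measure_ne_top _ _)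
    (ENNReal.mul_ne_top (ENNReal.pow_ne_top (measure_ne_top _ _))
      (ENNReal.pow_ne_top ENNReal.ofReal_ne_top))) (by norm_num)
  refine ⟨(p * q * (1 / 2)).toReal, ENNReal.toReal_pos
    (mul_ne_zero (mul_ne_zero hp0.ne' hq0) (by norm_num)) hfin, ?_⟩
  intro Ω _ P _ E U D u hpot hcen huni
  have H := hpot.unimodalAt hcen huni
  refine ⟨fun j _ => blockTime j, fun j => isStoppingTime_const _ _, ?_⟩
  rw [ENNReal.ofReal_toReal hfin]
  -- The values of $E_0$ for which the right gap is at least the left one: the only way in which the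
  -- event depends on $u$.
  set A := {e | u (radius e u) ≤ u (-radius e u)} with hA
  have hAm : MeasurableSet A := measurableSet_radius_le H
  set I := Set.Icc 1 (1 + ε')
  set F := headEvent E U m (Set.Icc 2 3 ∩ A) I (Set.Ioi (1 / 2))
  set G := headEvent E U m (Set.Icc 2 3 \ A) I (Set.Iio (1 / 2))
  set T := tailEvent E U ε' j₀ with hT
  have hPT : 1 / 2 ≤ P T := htail Ω P E U D
  have hm1 := (measurableSet_Icc (a := (2 : ℝ)) (b := 3)).inter hAm
  have hm2 := (measurableSet_Icc (a := (2 : ℝ)) (b := 3)).diff hAm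
  have hF : P (F ∩ T) = expMeasure 1 (Set.Icc 2 3 ∩ A) * q * P T := by
    rw [D.indep_head_tail hm1 measurableSet_Icc measurableSet_Ioi hm,
      D.measure_headEvent m hm1 measurableSet_Icc measurableSet_Ioi, volume_Ioi_half, mul_assoc
      (expMeasure 1 _)]
  have hG : P (G ∩ T) = expMeasure 1 (Set.Icc 2 3 \ A) * q * P T := by
    rw [D.indep_head_tail hm2 measurableSet_Icc measurableSet_Iio hm,
      D.measure_headEvent m hm2 measurableSet_Icc measurableSet_Iio, volume_Iio_half, mul_assoc
      (expMeasure 1 _)]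
  have hdisj : Disjoint (F ∩ T) (G ∩ T) := by
    refine Set.disjoint_left.2 fun ω h1 h2 => ?_
    exact (mem_headEvent h2.1).1.2 (mem_headEvent h1.1).1.2
  have hTm : MeasurableSet T := measurableSet_tailEvent (fun n _ => D.measurable_E n)
    (fun n _ => D.measurable_U n)
  have hGm : MeasurableSet G := Finset.measurableSet_biInter _ fun i _ => by
    rcases i with n | n
    · simp only [Sum.elim_inl]
      split_ifs
      · exact D.measurable_E n hm2
      · exact D.measurable_E n measurableSet_Icc
    · exact D.measurable_U n measurableSet_Iio
  -- The half-intervals for `U` have equal length, so the two cases differ only in the part of `[2,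
  -- 3]` that they use. These parts add up to `p`, whatever `u` is.
  have hsum : p * q * P T = P ((F ∩ T) ∪ (G ∩ T)) := by
    rw [measure_union hdisj (hGm.inter hTm), hF, hG, ← add_mul, ← add_mul,
      measure_inter_add_sdiff _ hAm]
  refine (mul_le_mul_right hPT _).trans (hsum.trans_le (measure_mono ?_))
  rintro ω hω j hj
  have hωT : TypicalTail (fun n => E n ω) (fun n => U n ω) capE badProb smallE windowLen gapLen
      ε' j₀ := hω.elim (fun h => h.2) (fun h => h.2)
  have hωH : TypicalHead (fun n => E n ω) ε' (blockTime j₀) := by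
    rw [hm]
    rcases hω with h | h
    · exact ⟨(mem_headEvent h.1).1.1, (mem_headEvent h.1).2.1⟩
    · exact ⟨(mem_headEvent h.1).1.1, (mem_headEvent h.1).2.1⟩
  refine GoodBlock.mono (min_le_left ε 1) H.le_height (goodBlock_potentialSeq H K B
    (fun n _ => capE_le n) hε0.le hε1 hωT hωH ?_ hj)
  rw [hm]
  rcases hω with h | h
  · exact Or.inl ⟨(mem_headEvent h.1).1.2, (mem_headEvent h.1).2.2⟩
  · exact Or.inr ⟨(not_le.1 (mem_headEvent h.1).1.2).le, (mem_headEvent h.1).2.2⟩
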